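/- **Setting.** Let $\mathrm{Tree}=\bigcup_{n\ge1}\mathrm{Tree}_n$ be the labelled trees given by $\mathrm{Tree}_1=\{T_1\}$ (one vertex) and $\mathrm{Tree}_{n+1}=\{T+i:\ T\in \mathrm{Tree}_n,\ 1\le i\le n\}$, where $T+i$ is $T$ with a new leaf $n+1$ attached at the vertex $i$; $|T|$ is the number of vertices. Let $t_*>0$, $\nu>0$, $K\in L^2(\mathbb R^d;\mathbb R^d)$. Let $h=(h_T)_{T\in \mathrm{Tree}}$, $h_T\in L^\infty([0,t_*],(L^1\cap L^2)(\mathbb R^{d|T|}))$, solve in the sense of distributions, with initial datum $h^0=(h^0_T)_T$, $h^0_T\in L^2(\mathbb R^{d|T|})$, the hierarchy $$\partial_t h_T+\sum_{i=1}^{|T|}\mathrm{div}_{x_i}\Big(\int_{\mathbb R^d}K(x_i-z)\,h_{T+i}(t,x_1,\dots,x_{|T|},z)\,dz\Big)=\nu\sum_{i=1}^{|T|}\Delta_{x_i}h_T,\qquad T\in \mathrm{Tree}$$ (test functions in $C_c^\infty([0,t_*)\times\mathbb R^{d|T|})$). For $\mu>0$ put $\|h\|_\mu=\sup_{T}\mu^{|T|/2}\|h_T\|_{L^2(\mathbb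 R^{d|T|})}$. Assume that for some $\lambda>0$ $$C_\lambda:=\operatorname*{ess\,sup}_{t\in[0,t_*]}\|h(t,\cdot)\|_\lambda<\infty .$$ **Theorem.** Let $p>1$, $1/p+1/p'=1$, $\theta\in(0,2^{-p'})$. There is a constant $C_{p,\theta}<\infty$, depending only on $p$ and $\theta$, such that for all such $d,t_*,\nu,K,\lambda,h,h^0$ the following holds. After modification on a null set of times, every $h_T$ is weakly continuous from $[0,t_*]$ to $L^2(\mathbb R^{d|T|})$ with $h_T(0)=h^0_T$, and, with $s(t):=\dfrac{\|K\|_{L^2}^2}{2\theta\lambda\nu}\,t$, for every $t\in[0,t_*]$ $$\|h(t,\cdot)\|_{\theta\lambda}\le C_\lambda\,C_{p,\theta}\,\exp\Big(p^{-\lceil s(t)\rceil}\,\log\frac{\|h^0\|_{\theta\lambda}}{C_\lambda}\Big).$$ If moreover $\theta\le e^{-1/\log p}$, then also, for every $t\in[0,t_*]$, $$\|h(t,\cdot)\|_{\theta\lambda}\le C_\lambda\,C_{p,\theta}\,\exp\Big(p^{-s(t)}\,\log\frac{\|h^0\|_{\theta\lambda}}{C_\lambda}\Big).$$ (The right-hand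 sides are read as $0$ if $h^0=0$ or $C_\lambda=0$.) In particular solutions are unique: if $h$ and $\tilde h$ solve the hierarchy as above with the same $\nu$, $K$ and $h^0$, and $\operatorname{ess\,sup}_t\|h(t,\cdot)\|_{\lambda_1}<\infty$, $\operatorname{ess\,sup}_t\|\tilde h(t,\cdot)\|_{\lambda_2}<\infty$ for some $\lambda_1,\lambda_2>0$, then for every $T$, $h_T(t,\cdot)=\tilde h_T(t,\cdot)$ for almost every $t\in[0,t_*]$. -/

import Mathlib

open MeasureTheory Set
open scoped ENNReal NNReal ContDiff

/-- Labelled trees of order `n`, by the recursion `Tree₁ = {T₁}`,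
`Treeₙ₊₁ = {T + i : T ∈ Treeₙ, i ∈ {1, …, n}}`: the tree `T.addLeaf i` is `T + i`, obtained from
`T` by attaching the new vertex `n + 1` as a leaf at the vertex `i`.
(A labelled tree of this kind determines `T` and `i`, so the constructors lose nothing.) -/
inductive LabeledTree : ℕ → Type
  | single : LabeledTree 1
  | addLeaf {n : ℕ} (T : LabeledTree n) (i : Fin n) : LabeledTree (n + 1)

/-- `ℝ^d` with its Euclidean structure. -/
abbrev Rd (d : ℕ) : Type := EuclideanSpace ℝ (Fin d)

/-- The space `ℝ^{d n}` of `n`-tuples `(x₁, …, xₙ)` of points of `ℝ^d`, with Lebesgue measure. -/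
abbrev Conf (d n : ℕ) : Type := Fin n → Rd d

/-- A family `(h_T)_T` indexed by all labelled trees, `h_T` being a function on `ℝ^{d|T|}`. -/
abbrev TreeFamily (d : ℕ) : Type := ∀ n : ℕ, LabeledTree n → Conf d n → ℝ

/-- A time-dependent family `(h_T(t, ·))_T`. -/
abbrev TreeFlow (d : ℕ) : Type := ∀ n : ℕ, LabeledTree n → ℝ → Conf d n → ℝ

/-- The member of the flow at time `t`. -/
def TreeFlow.slice {d : ℕ} (h : TreeFlow d) (t : ℝ) : TreeFamily d := fun n T => h n T t

noncomputable section

/-- `‖h‖_λ = sup_T λ^{|T|/2} ‖h_T‖_{L²(ℝ^{d|T|})}`, in `[0, ∞]`. -/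
def hierNorm {d : ℕ} (lam : ℝ) (h : TreeFamily d) : ℝ≥0∞ :=
  ⨆ (n : ℕ) (T : LabeledTree n),
    ENNReal.ofReal (lam ^ ((n : ℝ) / 2)) * eLpNorm (h n T) 2 volume

/-- Lebesgue measure on the time interval `[0, t_*]`. -/
def timeMeasure (tstar : ℝ) : Measure ℝ := volume.restrict (Icc 0 tstar)

/-- `C_λ = sup_{t ∈ [0, t_*]} ‖h(t, ·)‖_λ`, an essential supremum since the `h_T` are
`L^∞` in time. -/
def supHierNorm {d : ℕ} (tstar lam : ℝ) (h : TreeFlow d) : ℝ≥0∞ :=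
  essSup (fun t => hierNorm lam (h.slice t)) (timeMeasure tstar)

/-- `u ∈ L^∞([0, t_*], L^p(ℝ^{dn}))`. -/
def MemLinftyLp {d n : ℕ} (tstar : ℝ) (p : ℝ≥0∞) (u : ℝ → Conf d n → ℝ) : Prop :=
  AEStronglyMeasurable (Function.uncurry u) ((timeMeasure tstar).prod volume) ∧
    essSup (fun t => eLpNorm (u t) p volume) (timeMeasure tstar) < ⊤

/-- Test functions in `C_c^∞([0, t_*) × ℝ^{dn})`: they may be nonzero at `t = 0` (which is how
the initial datum enters) and vanish near `t = t_*`. -/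
structure IsTestFunction {d n : ℕ} (tstar : ℝ) (φ : ℝ × Conf d n → ℝ) : Prop where
  smooth : ContDiff ℝ ∞ φ
  compact : HasCompactSupport φ
  support : tsupport φ ⊆ Iio tstar ×ˢ univ

/-- `∂_t φ`. -/
def timeDeriv {d n : ℕ} (φ : ℝ × Conf d n → ℝ) (t : ℝ) (x : Conf d n) : ℝ :=
  fderiv ℝ φ (t, x) (1, 0)

/-- `v · ∇_{x_i} φ`. -/
def partialGrad {d n : ℕ} (φ : ℝ × Conf d n → ℝ) (t : ℝ) (x : Conf d n) (i : Fin n)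
    (v : Rd d) : ℝ :=
  fderiv ℝ φ (t, x) (0, Pi.single i v)

/-- `Δ_{x_i} φ`. -/
def partialLaplacian {d n : ℕ} (φ : ℝ × Conf d n → ℝ) (t : ℝ) (x : Conf d n) (i : Fin n) : ℝ :=
  Laplacian.laplacian (fun y : Rd d => φ (t, Function.update x i y)) (x i)

/-- The flux `∫ K(x_i - z) h_{T+i}(t, x₁, …, x_{|T|}, z) dz`. -/
def hierFlux {d : ℕ} (K : Rd d → Rd d) (h : TreeFlow d) {n : ℕ} (T : LabeledTree n) (i : Fin n)
    (t : ℝ) (x : Conf d n) : Rd d :=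
  ∫ z : Rd d, h (n + 1) (T.addLeaf i) t (Fin.snoc x z) • K (x i - z)

/-- `h ∈ L^∞([0, t_*], L¹ ∩ L²)` solves, in the sense of distributions and with initial datum
`h⁰`, the hierarchy
`∂_t h_T + ∑_i div_{x_i} ∫ K(x_i - z) h_{T+i}(t, x₁, …, x_{|T|}, z) dz = ν ∑_i Δ_{x_i} h_T`. -/
structure IsHierarchySolution {d : ℕ} (tstar ν : ℝ) (K : Rd d → Rd d) (h : TreeFlow d)
    (h0 : TreeFamily d) : Prop where
  memL1 : ∀ n (T : LabeledTree n), MemLinftyLp tstar 1 (h n T)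
  memL2 : ∀ n (T : LabeledTree n), MemLinftyLp tstar 2 (h n T)
  initial_memL2 : ∀ n (T : LabeledTree n), MemLp (h0 n T) 2 volume
  weak : ∀ n (T : LabeledTree n) (φ : ℝ × Conf d n → ℝ), IsTestFunction tstar φ →
    (∫ t in Icc 0 tstar, ∫ x : Conf d n,
        (h n T t x * (timeDeriv φ t x + ν * ∑ i, partialLaplacian φ t x i)
          + ∑ i, partialGrad φ t x i (hierFlux K h T i t x)))
      + ∫ x : Conf d n, h0 n T x * φ (0, x) = 0

/-- `g` is a version of `h` (equal to it at almost every time) for which every `g_T` is weakly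
continuous from `[0, t_*]` to `L²`, with `g(0) = h⁰`. -/
structure IsWeaklyContinuousVersion {d : ℕ} (tstar : ℝ) (h : TreeFlow d) (h0 : TreeFamily d)
    (g : TreeFlow d) : Prop where
  ae_eq : ∀ n (T : LabeledTree n), ∀ᵐ t ∂(timeMeasure tstar), g n T t =ᵐ[volume] h n T t
  memL2 : ∀ n (T : LabeledTree n), ∀ t ∈ Icc 0 tstar, MemLp (g n T t) 2 volume
  weak_cont : ∀ n (T : LabeledTree n) (ψ : Conf d n → ℝ), MemLp ψ 2 volume →
    ContinuousOn (fun t => ∫ x, g n T t x * ψ x) (Icc 0 tstar)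
  initial : ∀ n (T : LabeledTree n), g n T 0 =ᵐ[volume] h0 n T

/-- The number `‖K‖²_{L²} t / (2 θ λ ν)`. -/
def rescaledTime {d : ℕ} (K : Rd d → Rd d) (ν lam θ t : ℝ) : ℝ :=
  (eLpNorm K 2 volume).toReal ^ 2 * t / (2 * θ * lam * ν)

end

/-! Energy estimate: pairing the equation for h_T with h_T, Young's inequality absorbs the flux into
the dissipation, and Cauchy–Schwarz in z bounds the i-th flux by ‖K‖ ‖h_{T+i}‖. For x_T = (θλ)^{|T|}
‖h_T‖² / C_λ² and σ = ‖K‖² / (2θλν) this reads x_T(t) ≤ x_T(s) + σ |T| ∫ max_i x_{T+i}. Order n is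
controlled only by order n + 1; the a priori bound x_T ≤ θ^{|T|} closes the loop (`TreeInequality`).

Iteration: if all x_T are at most X at time s, climbing to order m yields x_T(t) ≤ (X + θ^m)(1 + σ(t
- s))^m for each m ≥ |T|. Choosing θ^m comparable to X gives x_T(t) ≤ (2/θ) X^e whenever (1 + σ(t -
s)) θ ≤ θ^e (`TreeInequality.step`). On a unit of rescaled time e = 1/p is admissible, because θ <
2^{-p'} gives 2θ ≤ θ^{1/p}. Concatenating k units produces the exponent p^{-k}, while the constants
stay bounded since 1 + 1/p + 1/p² + … = p'. For the bound without the ceiling, one last step of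
fractional length r uses e = p^{-r}; this needs (1 + r) θ ≤ θ^{p^{-r}} on [0, 1], where θ ≤
e^{-1/log p} enters.

Rigour for distributional solutions: product test functions, the du Bois-Reymond lemma in time and
Riesz representation give a weakly continuous version. Convolution with an even mollifier is
self-adjoint, with its derivative skew-adjoint, and all these operators commute; an abstract energy
inequality holds for the regularised curve, and the mollifier is then removed
(`IsWeakEvolution.energy_le`).

Uniqueness is the case X = 0 for the difference of two solutions, since 0^e = 0. -/

set_option linter.unusedSectionVars false

/-! ### Iteration of the scalar inequalities -/

/-- The scalar system of integral inequalities satisfied by the suitably normalised squared `L²`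
norms `x_T(t)` of a solution of the hierarchy. -/
structure TreeInequality (tstar σ θ : ℝ) (x : ∀ n : ℕ, LabeledTree n → ℝ → ℝ) : Prop where
  le_pow : ∀ n T, ∀ t ∈ Icc 0 tstar, x n T t ≤ θ ^ n
  energy : ∀ (n : ℕ) (T : LabeledTree n) (s t : ℝ), 0 ≤ s → s ≤ t → t ≤ tstar →
    ∀ k : ℝ → ℝ, Continuous k →
      (∀ i, ∀ r ∈ Icc s t, x (n + 1) (T.addLeaf i) r ≤ k r) →
      x n T t ≤ x n T s + σ * n * ∫ r in s..t, k r

/-- For m = n + 1 + k one has (j + 1) C(m, j + 1) = (m - j) C(m, j), and m - j ≥ n since j ≤ k. This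
absorbs the factor n of the energy inequality into the next binomial coefficient. -/
theorem choose_mul_div_succ_le (n k j : ℕ) (hj : j ≤ k) :
    (n : ℝ) * ((n + 1 + k).choose j) / (j + 1) ≤ (n + 1 + k).choose (j + 1) := by
  rw [div_le_iff₀ (by positivity)]
  have h := Nat.choose_succ_right_eq (n + 1 + k) j
  have h2 : n * (n + 1 + k).choose j ≤ (n + 1 + k).choose (j + 1) * (j + 1) := by
    rw [h, mul_comm]
    exact Nat.mul_le_mul le_rfl (by omega)
  exact_mod_cast h2

theorem integral_sum_choose_mul_pow (s t σ : ℝ) (m k : ℕ) :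
    σ * ∫ r in s..t, ∑ j ∈ Finset.range (k + 1), (m.choose j : ℝ) * (σ * (r - s)) ^ j
      = ∑ j ∈ Finset.range (k + 1), (m.choose j : ℝ) * (σ * (t - s)) ^ (j + 1) / (j + 1) := by
  rw [intervalIntegral.integral_finsetSum]
  · rw [Finset.mul_sum]
    refine Finset.sum_congr rfl fun j _ => ?_
    have : ∀ r : ℝ, (m.choose j : ℝ) * (σ * (r - s)) ^ j
        = ((m.choose j : ℝ) * σ ^ j) * (r - s) ^ j := fun r => by rw [mul_pow]; ring
    simp_rw [this]
    rw [intervalIntegral.integral_const_mul,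
      intervalIntegral.integral_comp_sub_right (fun r => r ^ j) s, integral_pow]
    rw [sub_self, zero_pow (Nat.succ_ne_zero j)]
    rw [mul_pow]
    ring
  · intro j _
    exact Continuous.intervalIntegrable (by fun_prop) _ _

namespace TreeInequality

variable {tstar σ θ : ℝ} {x : ∀ n : ℕ, LabeledTree n → ℝ → ℝ}

/-- Induction on the number k of orders climbed. The bound for order n + 1 and k is inserted into
the energy inequality for order n; the top order n + 1 + k is unchanged, so the prefactor survives,
integration raises each power by one, and the new term j = 0 accounts for x_T(s). -/
theorem le_sum_choose (h : TreeInequality tstar σ θ x) (hσ : 0 ≤ σ) (hθ : 0 ≤ θ) {s X : ℝ}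
    (hs : 0 ≤ s) (hX : 0 ≤ X) (hx : ∀ n T, x n T s ≤ X) (k : ℕ) :
    ∀ (n : ℕ) (T : LabeledTree n) (t : ℝ), s ≤ t → t ≤ tstar →
      x n T t ≤ (X + θ ^ (n + k)) *
        ∑ j ∈ Finset.range (k + 1), ((n + k).choose j : ℝ) * (σ * (t - s)) ^ j := by
  induction k with
  | zero =>
    intro n T t hst ht
    have := h.le_pow n T t ⟨hs.trans hst, ht⟩
    simp only [add_zero, zero_add, Finset.range_one, Finset.sum_singleton, Nat.choose_zero_right,
      pow_zero, Nat.cast_one, mul_one]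
    linarith
  | succ k ih =>
    intro n T t hst ht
    have hA : 0 ≤ X + θ ^ (n + 1 + k) := by positivity
    have hy : 0 ≤ σ * (t - s) := mul_nonneg hσ (by linarith)
    have key := h.energy n T s t hs hst ht
      (fun r => (X + θ ^ (n + 1 + k)) *
        ∑ j ∈ Finset.range (k + 1), ((n + 1 + k).choose j : ℝ) * (σ * (r - s)) ^ j)
      (by fun_prop) (fun i r hr => ih (n + 1) (T.addLeaf i) r hr.1 (hr.2.trans ht))
    rw [intervalIntegral.integral_const_mul] at key
    have e1 : σ * n * ((X + θ ^ (n + 1 + k)) * ∫ r in s..t,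
        ∑ j ∈ Finset.range (k + 1), ((n + 1 + k).choose j : ℝ) * (σ * (r - s)) ^ j)
        = (X + θ ^ (n + 1 + k)) * (n * ∑ j ∈ Finset.range (k + 1),
          ((n + 1 + k).choose j : ℝ) * (σ * (t - s)) ^ (j + 1) / (j + 1)) := by
      rw [← integral_sum_choose_mul_pow]; ring
    rw [e1] at key
    have e2 : (n : ℝ) * ∑ j ∈ Finset.range (k + 1),
          ((n + 1 + k).choose j : ℝ) * (σ * (t - s)) ^ (j + 1) / (j + 1)
        ≤ ∑ j ∈ Finset.range (k + 1),
          ((n + 1 + k).choose (j + 1) : ℝ) * (σ * (t - s)) ^ (j + 1) := by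
      rw [Finset.mul_sum]
      refine Finset.sum_le_sum fun j hj => ?_
      have := choose_mul_div_succ_le n k j (by simpa [Nat.lt_succ_iff] using hj)
      calc (n : ℝ) * (((n + 1 + k).choose j : ℝ) * (σ * (t - s)) ^ (j + 1) / (j + 1))
          = ((n : ℝ) * ((n + 1 + k).choose j) / (j + 1)) * (σ * (t - s)) ^ (j + 1) := by ring
        _ ≤ _ := by gcongr
    rw [show n + (k + 1) = n + 1 + k by ring, Finset.sum_range_succ' _ (k + 1)]
    have e3 := mul_le_mul_of_nonneg_left e2 hA
    have e4 : (0 : ℝ) ≤ θ ^ (n + 1 + k) := by positivity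
    have := hx n T
    simp only [Nat.choose_zero_right, pow_zero, Nat.cast_one, mul_one, mul_add]
    linarith

theorem le_mul_one_add_pow (h : TreeInequality tstar σ θ x) (hσ : 0 ≤ σ) (hθ : 0 ≤ θ) {s X : ℝ}
    (hs : 0 ≤ s) (hX : 0 ≤ X) (hx : ∀ n T, x n T s ≤ X) {n m : ℕ} (hnm : n ≤ m)
    (T : LabeledTree n) {t : ℝ} (hst : s ≤ t) (ht : t ≤ tstar) :
    x n T t ≤ (X + θ ^ m) * (1 + σ * (t - s)) ^ m := by
  obtain ⟨k, rfl⟩ := Nat.exists_eq_add_of_le hnm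
  have hy : 0 ≤ σ * (t - s) := mul_nonneg hσ (by linarith)
  refine (h.le_sum_choose hσ hθ hs hX hx k n T t hst ht).trans ?_
  refine mul_le_mul_of_nonneg_left ?_ (by positivity)
  rw [add_comm 1, add_pow]
  simp only [one_pow, mul_one]
  calc ∑ j ∈ Finset.range (k + 1), ((n + k).choose j : ℝ) * (σ * (t - s)) ^ j
      ≤ ∑ j ∈ Finset.range (n + k + 1), ((n + k).choose j : ℝ) * (σ * (t - s)) ^ j :=
        Finset.sum_le_sum_of_subset_of_nonneg
          (Finset.range_subset_range.2 (by omega)) fun _ _ _ => by positivity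
    _ = _ := Finset.sum_congr rfl fun _ _ => mul_comm _ _

/-- With θ^{m+1} < X ≤ θ^m both contributions are at most θ^m (1 + y)^m, where y = σ(t - s), hence
at most (θ^m)^e, and θ^m < X/θ. Trees with more than m vertices, and data X > 1, are covered by the
a priori bound alone. -/
theorem step_of_pos (h : TreeInequality tstar σ θ x) (hσ : 0 ≤ σ) (hθ : 0 < θ) (hθ1 : θ < 1)
    {s t X e : ℝ} (hs : 0 ≤ s) (hst : s ≤ t) (ht : t ≤ tstar) (hX : 0 < X)
    (hx : ∀ n T, x n T s ≤ X) (he0 : 0 < e) (he1 : e ≤ 1)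
    (he : (1 + σ * (t - s)) * θ ≤ θ ^ e) (n : ℕ) (T : LabeledTree n) :
    x n T t ≤ 2 / θ * X ^ e := by
  have hy : 0 ≤ σ * (t - s) := mul_nonneg hσ (by linarith)
  have h2θ : 1 ≤ 2 / θ := by rw [le_div_iff₀ hθ]; linarith
  have hXe : 0 < X ^ e := Real.rpow_pos_of_pos hX e
  rcases le_or_gt X 1 with hX1 | hX1
  · obtain ⟨m, hm1, hm2⟩ := exists_nat_pow_near_of_lt_one hX hX1 hθ hθ1
    rcases le_or_gt n m with hnm | hnm
    · calc x n T t ≤ (X + θ ^ m) * (1 + σ * (t - s)) ^ m :=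
            h.le_mul_one_add_pow hσ hθ.le hs hX.le hx hnm T hst ht
        _ ≤ (θ ^ m + θ ^ m) * (1 + σ * (t - s)) ^ m := by gcongr
        _ = 2 * ((1 + σ * (t - s)) * θ) ^ m := by rw [mul_pow]; ring
        _ ≤ 2 * (θ ^ e) ^ m := by gcongr
        _ = 2 * (θ ^ m) ^ e := by
            rw [← Real.rpow_natCast (θ ^ e), ← Real.rpow_mul hθ.le, ← Real.rpow_natCast θ,
              ← Real.rpow_mul hθ.le, mul_comm e]
        _ ≤ 2 * (X / θ) ^ e := by
            gcongr
            rw [le_div_iff₀ hθ, ← pow_succ]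
            exact hm1.le
        _ = 2 / θ ^ e * X ^ e := by rw [Real.div_rpow hX.le hθ.le]; ring
        _ ≤ 2 / θ * X ^ e := by
            gcongr
            simpa using Real.rpow_le_rpow_of_exponent_ge hθ hθ1.le he1
    · calc x n T t ≤ θ ^ n := h.le_pow n T t ⟨hs.trans hst, ht⟩
        _ ≤ θ ^ (m + 1) := pow_le_pow_of_le_one hθ.le hθ1.le hnm
        _ ≤ X := hm1.le
        _ ≤ X ^ e := by simpa using Real.rpow_le_rpow_of_exponent_ge hX hX1 he1
        _ ≤ 2 / θ * X ^ e := le_mul_of_one_le_left hXe.le h2θ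
  · calc x n T t ≤ θ ^ n := h.le_pow n T t ⟨hs.trans hst, ht⟩
      _ ≤ 1 := pow_le_one₀ hθ.le hθ1.le
      _ ≤ X ^ e := Real.one_le_rpow hX1.le he0.le
      _ ≤ 2 / θ * X ^ e := le_mul_of_one_le_left hXe.le h2θ

/-- No power of θ is comparable to X = 0, so the bound is taken at Y > X and Y decreases to X. -/
theorem step (h : TreeInequality tstar σ θ x) (hσ : 0 ≤ σ) (hθ : 0 < θ) (hθ1 : θ < 1)
    {s t X e : ℝ} (hs : 0 ≤ s) (hst : s ≤ t) (ht : t ≤ tstar) (hX : 0 ≤ X)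
    (hx : ∀ n T, x n T s ≤ X) (he0 : 0 < e) (he1 : e ≤ 1)
    (he : (1 + σ * (t - s)) * θ ≤ θ ^ e) (n : ℕ) (T : LabeledTree n) :
    x n T t ≤ 2 / θ * X ^ e := by
  have hc : Filter.Tendsto (fun Y : ℝ => 2 / θ * Y ^ e) (nhdsWithin X (Ioi X))
      (nhds (2 / θ * X ^ e)) :=
    ((Real.continuousAt_rpow_const X e (Or.inr he0.le)).const_mul (2 / θ)).tendsto.mono_left
      nhdsWithin_le_nhds
  refine ge_of_tendsto hc ?_
  filter_upwards [self_mem_nhdsWithin] with Y hY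
  exact h.step_of_pos hσ hθ hθ1 hs hst ht (hX.trans_lt hY) (fun n T => (hx n T).trans hY.le)
    he0 he1 he n T

/-- Each step sends A X^q to (2/θ) A^{1/p} X^{q/p}; the exponent p/(p - 1) of the constant is the
fixed point of a ↦ 1 + a/p. -/
theorem le_of_rescaled_le_nat (h : TreeInequality tstar σ θ x) (hσ : 0 ≤ σ) (hθ : 0 < θ)
    (hθ1 : θ < 1) {p X : ℝ} (hp : 1 < p) (hθp : 2 * θ ≤ θ ^ p⁻¹) (hX : 0 ≤ X)
    (hx : ∀ n T, x n T 0 ≤ X) (k : ℕ) :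
    ∀ (n : ℕ) (T : LabeledTree n), ∀ t ∈ Icc 0 tstar, σ * t ≤ k →
      x n T t ≤ (2 / θ) ^ (p / (p - 1)) * X ^ (p ^ (-(k : ℝ))) := by
  have h2θ : 1 ≤ 2 / θ := by rw [le_div_iff₀ hθ]; linarith
  have hp0 : 0 < p := by linarith
  have hp1 : 0 < p - 1 := by linarith
  have hq : 1 ≤ p / (p - 1) := by rw [le_div_iff₀ hp1]; linarith
  induction k with
  | zero =>
    intro n T t ht hk
    have h0 : σ * t = 0 := le_antisymm (by simpa using hk) (mul_nonneg hσ ht.1)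
    refine (h.step hσ hθ hθ1 le_rfl ht.1 ht.2 hX hx one_pos le_rfl (by simp [h0]) n T).trans ?_
    simp only [Nat.cast_zero, neg_zero, Real.rpow_zero]
    gcongr
    simpa using Real.rpow_le_rpow_of_exponent_le h2θ hq
  | succ k ih =>
    intro n T t ht hk
    have hk0 : (0 : ℝ) < k + 1 := by positivity
    have hk' : σ * t ≤ k + 1 := by exact_mod_cast hk
    -- Cutting [0, t] proportionally makes the last piece of rescaled length at most 1 without
    -- dividing by σ, which may vanish.
    set s := t * (k / (k + 1)) with hs
    have hs0 : 0 ≤ s := mul_nonneg ht.1 (by positivity)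
    have hst : s ≤ t := mul_le_of_le_one_right ht.1 (by rw [div_le_one hk0]; linarith)
    have hsk : σ * s ≤ k := by
      rw [hs, ← mul_assoc, ← mul_div_assoc, div_le_iff₀ hk0]
      nlinarith [Nat.cast_nonneg (α := ℝ) k]
    have hd : σ * (t - s) ≤ 1 := by
      have : σ * (t - s) = σ * t / (k + 1) := by rw [hs]; field_simp; ring
      rw [this, div_le_one hk0]; exact hk'
    set Y := (2 / θ) ^ (p / (p - 1)) * X ^ (p ^ (-(k : ℝ))) with hY
    have hY0 : 0 ≤ Y := by positivity
    have := h.step hσ hθ hθ1 hs0 hst ht.2 hY0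
      (fun n T => ih n T s ⟨hs0, hst.trans ht.2⟩ hsk) (inv_pos.2 hp0) (inv_le_one_of_one_le₀ hp.le)
      (le_trans (by gcongr; linarith) hθp) n T
    refine this.trans_eq ?_
    rw [hY, Real.mul_rpow (by positivity) (by positivity), ← Real.rpow_mul (by positivity),
      ← Real.rpow_mul hX, ← mul_assoc]
    congr 2
    · nth_rewrite 1 [← Real.rpow_one (2 / θ)]
      rw [← Real.rpow_add (by positivity)]
      congr 1
      field_simp
      ring
    · rw [← Real.rpow_neg_one, ← Real.rpow_add hp0]
      congr 1
      push_cast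
      ring

/-- After ⌊S⌋ units a step of rescaled length S - ⌊S⌋ follows, and the exponents multiply to p^{-S}.
The additional factor 2/θ pays for that step. -/
theorem le_of_rescaled_eq (h : TreeInequality tstar σ θ x) (hσ : 0 ≤ σ) (hθ : 0 < θ)
    (hθ1 : θ < 1) {p X : ℝ} (hp : 1 < p) (hθp : 2 * θ ≤ θ ^ p⁻¹)
    (hfrac : ∀ r ∈ Icc (0 : ℝ) 1, (1 + r) * θ ≤ θ ^ (p ^ (-r))) (hX : 0 ≤ X)
    (hx : ∀ n T, x n T 0 ≤ X) {n : ℕ} (T : LabeledTree n) {t : ℝ} (ht : t ∈ Icc 0 tstar) :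
    x n T t ≤ (2 / θ) ^ (p / (p - 1) + 1) * X ^ (p ^ (-(σ * t))) := by
  have h2θ : 1 ≤ 2 / θ := by rw [le_div_iff₀ hθ]; linarith
  have hp0 : 0 < p := by linarith
  have hp1 : 0 < p - 1 := by linarith
  have hq : 0 ≤ p / (p - 1) := by positivity
  set S := σ * t with hS
  have hS0 : 0 ≤ S := mul_nonneg hσ ht.1
  set k := ⌊S⌋₊ with hk
  have hkS : (k : ℝ) ≤ S := Nat.floor_le hS0
  have hSk : S < k + 1 := Nat.lt_floor_add_one S
  have hke : (k : ℝ) / S ≤ 1 := div_le_one_of_le₀ hkS hS0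
  -- For S = 0 the quotient is 0 by convention, so s = 0, as it should be.
  set s := t * (k / S) with hs
  have hs0 : 0 ≤ s := mul_nonneg ht.1 (by positivity)
  have hst : s ≤ t := mul_le_of_le_one_right ht.1 hke
  have hsk : σ * s = k := by
    rcases hS0.eq_or_lt with h0 | h0
    · have : (k : ℝ) = 0 := le_antisymm (by rwa [h0]) (by positivity)
      rw [hs, this]; simp
    · rw [hs, ← mul_assoc, ← hS]; field_simp
  have hd : σ * (t - s) = S - k := by rw [mul_sub, hsk]
  set Y := (2 / θ) ^ (p / (p - 1)) * X ^ (p ^ (-(k : ℝ))) with hY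
  have hY0 : 0 ≤ Y := by positivity
  have he1 : p ^ (-(S - k)) ≤ 1 := Real.rpow_le_one_of_one_le_of_nonpos hp.le (by linarith)
  have := h.step hσ hθ hθ1 hs0 hst ht.2 hY0
    (fun n T => h.le_of_rescaled_le_nat hσ hθ hθ1 hp hθp hX hx k n T s ⟨hs0, hst.trans ht.2⟩ hsk.le)
    (Real.rpow_pos_of_pos hp0 _) he1
    (by rw [hd]; exact hfrac _ ⟨by linarith, by linarith⟩) n T
  refine this.trans ?_
  rw [hY, Real.mul_rpow (by positivity) (by positivity), ← Real.rpow_mul (by positivity),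
    ← Real.rpow_mul hX, ← mul_assoc, ← Real.rpow_add hp0,
    show -(k : ℝ) + -(S - k) = -S by ring, Real.rpow_add (by positivity), Real.rpow_one,
    mul_comm (2 / θ)]
  gcongr
  exact mul_le_of_le_one_right hq he1

end TreeInequality

/-! ### Elementary conditions on θ -/

/-- Since p'(1 - 1/p) = 1, the hypothesis amounts to θ^{1 - 1/p} < 1/2. -/
theorem two_mul_le_rpow_inv {p θ : ℝ} (hp : 1 < p) (hθ : 0 < θ)
    (h : θ < 2 ^ (-(p / (p - 1)))) : 2 * θ ≤ θ ^ p⁻¹ := by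
  have hp1 : 0 < p - 1 := by linarith
  have h1 : θ ^ (1 - p⁻¹) ≤ 2⁻¹ := by
    have : 0 ≤ 1 - p⁻¹ := by have := inv_le_one_of_one_le₀ hp.le; linarith
    refine (Real.rpow_le_rpow hθ.le h.le this).trans_eq ?_
    have he : -(p / (p - 1)) * (1 - p⁻¹) = -1 := by field_simp
    rw [← Real.rpow_mul (by norm_num), he, Real.rpow_neg_one]
  have h2 : θ = θ ^ p⁻¹ * θ ^ (1 - p⁻¹) := by
    rw [← Real.rpow_add hθ]; simp
  have h3 : 0 < θ ^ p⁻¹ := Real.rpow_pos_of_pos hθ _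
  nlinarith

theorem theta_lt_one {p θ : ℝ} (hp : 1 < p) (h : θ < 2 ^ (-(p / (p - 1)))) : θ < 1 := by
  refine h.trans_le (Real.rpow_le_one_of_one_le_of_nonpos (by norm_num) ?_)
  have : 0 < p - 1 := by linarith
  have : 0 ≤ p / (p - 1) := by positivity
  linarith

/-- The function `r ↦ 1 - p^{-r} - log (1 + r) / L` is first increasing, then decreasing, so that it
is nonnegative on `[0, 1]` as soon as it is so at `1`. -/
theorem log_one_add_le_of_le {p L : ℝ} (hp : 1 < p) (hL : 0 < L) (hLp : 1 ≤ L * Real.log p)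
    (h1 : Real.log 2 ≤ (1 - p⁻¹) * L) {r : ℝ} (hr : r ∈ Icc (0 : ℝ) 1) :
    Real.log (1 + r) ≤ (1 - p ^ (-r)) * L := by
  have hp0 : 0 < p := by linarith
  have hlp : 0 < Real.log p := Real.log_pos hp
  set F : ℝ → ℝ := fun r => (1 - p ^ (-r)) * L - Real.log (1 + r) with hF
  set u : ℝ → ℝ := fun r => Real.log (1 + r) - r * Real.log p with hu
  have hdF : ∀ r : ℝ, 0 ≤ r →
      HasDerivAt F (p ^ (-r) * Real.log p * L - 1 / (1 + r)) r := by
    intro r hr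
    have a := ((hasDerivAt_neg r).const_rpow hp0).const_sub 1 |>.mul_const L
    have b := ((hasDerivAt_id r).const_add 1).log (by simp only [id]; positivity)
    refine (a.sub b).congr_deriv ?_
    simp only [id]
    ring
  have hpe : ∀ r : ℝ, p ^ (-r) = Real.exp (-(r * Real.log p)) := fun r => by
    rw [Real.rpow_def_of_pos hp0]; ring_nf
  -- The sign of F' is that of e^u L log p - 1, where u is concave, u(0) = 0 and L log p ≥ 1.
  have huF : ∀ r : ℝ, 0 ≤ r → p ^ (-r) * Real.log p * L - 1 / (1 + r)
      = (Real.exp (u r) * (L * Real.log p) - 1) / (1 + r) := by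
    intro r hr
    have : Real.exp (u r) = (1 + r) * p ^ (-r) := by
      simp only [hu]
      rw [hpe, sub_eq_add_neg, Real.exp_add, Real.exp_log (by positivity)]
    rw [this]
    have : (1 + r) ≠ 0 := by positivity
    field_simp
  have hconc : ConcaveOn ℝ (Ici 0) u := by
    have h1 : ConcaveOn ℝ (Ici 0) fun r : ℝ => Real.log (1 + r) := by
      have := strictConcaveOn_log_Ioi.concaveOn.comp_affineMap
        (AffineMap.const ℝ ℝ (1 : ℝ) + AffineMap.id ℝ ℝ)
      refine (this.subset ?_ (convex_Ici 0))
      intro r hr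
      have : (0 : ℝ) ≤ r := hr
      simp only [mem_preimage, AffineMap.coe_add, AffineMap.coe_const, AffineMap.coe_id,
        Pi.add_apply, Function.const_apply, id, mem_Ioi]
      linarith
    refine h1.sub (((convexOn_id (convex_Ici (0 : ℝ))).smul hlp.le).congr fun r _ => ?_)
    simp [mul_comm]
  have hu0 : u 0 = 0 := by simp [hu]
  have hF0 : F 0 = 0 := by simp [hF]
  have hF1 : 0 ≤ F 1 := by
    simp only [hF, Real.rpow_neg_one]
    norm_num
    exact h1
  have hFc : ContinuousOn F (Ici 0) := fun r hr => (hdF r hr).continuousAt.continuousWithinAt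
  suffices 0 ≤ F r by simp only [hF] at this; linarith
  -- If F'(r) ≥ 0, concavity of u gives F' ≥ 0 on [0, r] and F(r) is compared with F(0) = 0. If
  -- F'(r) < 0, then u(r) < 0 = u(0), so u stays below u(r) on [r, 1] and F(r) is compared with
  -- F(1).
  rcases le_or_gt 1 (Real.exp (u r) * (L * Real.log p)) with hc | hc
  · have : MonotoneOn F (Icc 0 r) := by
      refine monotoneOn_of_deriv_nonneg (convex_Icc 0 r) (hFc.mono Icc_subset_Ici_self)
        (fun y hy => ((hdF y ?_).differentiableAt.differentiableWithinAt)) fun y hy => ?_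
      · rw [interior_Icc] at hy; exact hy.1.le
      · rw [interior_Icc] at hy
        rw [(hdF y hy.1.le).deriv, huF y hy.1.le]
        have hy0 : 0 < 1 + y := by linarith [hy.1]
        refine div_nonneg (sub_nonneg.2 ?_) hy0.le
        have hmin := hconc.min_le_of_mem_Icc (x := 0) (y := r) (z := y) self_mem_Ici hr.1
          ⟨hy.1.le, hy.2.le⟩
        rcases min_le_iff.1 hmin with h | h
        · rw [hu0] at h
          have := Real.one_le_exp h
          nlinarith
        · refine hc.trans ?_
          gcongr
    have := this ⟨le_rfl, hr.1⟩ ⟨hr.1, le_rfl⟩ hr.1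
    rwa [hF0] at this
  · have : AntitoneOn F (Icc r 1) := by
      refine antitoneOn_of_deriv_nonpos (convex_Icc r 1)
        (hFc.mono fun y hy => hr.1.trans hy.1)
        (fun y hy => ((hdF y ?_).differentiableAt.differentiableWithinAt)) fun y hy => ?_
      · rw [interior_Icc] at hy; exact hr.1.trans hy.1.le
      · rw [interior_Icc] at hy
        have hy0 : 0 ≤ y := hr.1.trans hy.1.le
        rw [(hdF y hy0).deriv, huF y hy0]
        refine div_nonpos_of_nonpos_of_nonneg (sub_nonpos.2 ?_) (by linarith)
        refine le_trans ?_ hc.le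
        gcongr
        have hmin := hconc.min_le_of_mem_Icc (x := 0) (y := y) (z := r) self_mem_Ici hy0
          ⟨hr.1, hy.1.le⟩
        rcases min_le_iff.1 hmin with h | h
        · rw [hu0] at h
          have := Real.one_le_exp h
          nlinarith
        · exact h
    exact hF1.trans (this ⟨le_rfl, hr.2⟩ ⟨hr.2, le_rfl⟩ hr.2)

/-- After taking logarithms, `hθp` says that the difference of the two sides has nonnegative slope
at r = 0, and `h` gives the inequality at r = 1. -/
theorem one_add_mul_le_rpow {p θ : ℝ} (hp : 1 < p) (hθ : 0 < θ)
    (h : θ < 2 ^ (-(p / (p - 1)))) (hθp : θ ≤ Real.exp (-1 / Real.log p)) {r : ℝ}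
    (hr : r ∈ Icc (0 : ℝ) 1) : (1 + r) * θ ≤ θ ^ (p ^ (-r)) := by
  have hlp : 0 < Real.log p := Real.log_pos hp
  have hL : 0 < -Real.log θ := neg_pos.2 (Real.log_neg hθ (theta_lt_one hp h))
  have hLp : 1 ≤ -Real.log θ * Real.log p := by
    have := (Real.log_le_iff_le_exp hθ).2 hθp
    rw [le_div_iff₀ hlp] at this
    linarith
  have h1 : Real.log 2 ≤ (1 - p⁻¹) * -Real.log θ := by
    have := Real.log_le_log (by positivity) (two_mul_le_rpow_inv hp hθ h)
    rw [Real.log_mul (by norm_num) hθ.ne', Real.log_rpow hθ] at this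
    linarith
  have := log_one_add_le_of_le hp hL hLp h1 hr
  have h1r : 0 < 1 + r := by linarith [hr.1]
  rw [← Real.log_le_log_iff (by positivity) (Real.rpow_pos_of_pos hθ _),
    Real.log_mul h1r.ne' hθ.ne', Real.log_rpow hθ]
  linarith

-- Energy inequality for an abstract regularised evolution

local notation "⟪" x ", " y "⟫" => inner ℝ x y

/-- On a partition into N + 1 equal pieces the quadratic errors add up to C (b - a)² / (N + 1). This
replaces differentiation in time. -/
theorem le_of_sub_le_mul_sq {φ : ℝ → ℝ} {a b C : ℝ} (hab : a ≤ b)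
    (h : ∀ s t, a ≤ s → s ≤ t → t ≤ b → φ t - φ s ≤ C * (t - s) ^ 2) : φ b ≤ φ a := by
  have key : ∀ N : ℕ, φ b - φ a ≤ C * (b - a) ^ 2 * (1 / ((N : ℝ) + 1)) := by
    intro N
    have hN : (0 : ℝ) < N + 1 := by positivity
    set p : ℕ → ℝ := fun i => a + i * ((b - a) / (N + 1)) with hp
    have hd : 0 ≤ (b - a) / (N + 1) := div_nonneg (by linarith) hN.le
    have hp0 : p 0 = a := by simp [hp]
    have hpN : p (N + 1) = b := by simp only [hp]; push_cast; field_simp; ring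
    have hmono : Monotone p := fun i j hij => by
      simp only [hp]
      gcongr
    calc φ b - φ a = ∑ i ∈ Finset.range (N + 1), (φ (p (i + 1)) - φ (p i)) := by
          rw [Finset.sum_range_sub (fun i => φ (p i)), hp0, hpN]
      _ ≤ ∑ _i ∈ Finset.range (N + 1), C * ((b - a) / (N + 1)) ^ 2 := by
          refine Finset.sum_le_sum fun i hi => ?_
          have := h (p i) (p (i + 1)) (hp0 ▸ hmono (Nat.zero_le i)) (hmono (Nat.le_succ i))
            (hpN ▸ hmono (Finset.mem_range.1 hi))
          rwa [show p (i + 1) - p i = (b - a) / (N + 1) by simp only [hp]; push_cast; ring] at this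
      _ = C * (b - a) ^ 2 * (1 / ((N : ℝ) + 1)) := by
          rw [Finset.sum_const, Finset.card_range, nsmul_eq_mul]
          push_cast
          field_simp
  have hlim : Filter.Tendsto (fun N : ℕ => C * (b - a) ^ 2 * (1 / ((N : ℝ) + 1))) Filter.atTop
      (nhds (C * (b - a) ^ 2 * 0)) := tendsto_one_div_add_atTop_nhds_zero_nat.const_mul _
  have := ge_of_tendsto' hlim key
  linarith

section

variable {H ι : Type*} [NormedAddCommGroup H] [InnerProductSpace ℝ H] [Fintype ι]

/-- Energy inequality for an abstract regularised evolution: `J` is a mollifier and the `D j` are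
mollified partial derivatives. -/
theorem energy_le_of_regularization {ν T M : ℝ} (hν : 0 < ν) (J : H →L[ℝ] H)
    (D : ι → H →L[ℝ] H) (hJ : ∀ v w, ⟪J v, w⟫ = ⟪v, J w⟫)
    (hD : ∀ j v w, ⟪D j v, w⟫ = -⟪v, D j w⟫) (hJD : ∀ j v, J (D j v) = D j (J v))
    (hJ1 : ∀ v, ‖J v‖ ≤ ‖v‖) {g : ℝ → H} {f : ι → ℝ → H}
    (hgM : ∀ t ∈ Icc 0 T, ‖g t‖ ≤ M) (hfM : ∀ j, ∀ t ∈ Icc 0 T, ‖f j t‖ ≤ M)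
    (hgc : ∀ v, ContinuousOn (fun t => ⟪g t, v⟫) (Icc 0 T))
    (hfc : ∀ j v, ContinuousOn (fun t => ⟪f j t, v⟫) (Icc 0 T))
    (hid : ∀ v s t, 0 ≤ s → s ≤ t → t ≤ T → ⟪J (g t) - J (g s), J v⟫ =
      ∫ r in s..t, ∑ j, (-ν * ⟪D j (g r), D j v⟫ + ⟪J (f j r), D j v⟫))
    {s t : ℝ} (hs : 0 ≤ s) (hst : s ≤ t) (ht : t ≤ T) {k : ℝ → ℝ} (hk : Continuous k)
    (hfk : ∀ r ∈ Icc s t, ∑ j, ‖f j r‖ ^ 2 ≤ k r) :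
    ‖J (J (J (g t)))‖ ^ 2 ≤ ‖J (J (J (g s)))‖ ^ 2 + (2 * ν)⁻¹ * ∫ r in s..t, k r := by
  have hM : 0 ≤ M := (norm_nonneg _).trans (hgM s ⟨hs, hst.trans ht⟩)
  have hcont : ∀ v, ContinuousOn
      (fun r => ∑ j, (-ν * ⟪D j (g r), D j v⟫ + ⟪J (f j r), D j v⟫)) (Icc 0 T) := by
    intro v
    refine continuousOn_finsetSum _ fun j _ => ?_
    simp only [hD, hJ]
    exact (continuousOn_const.mul (hgc _).neg).add (hfc j _)
  have hint : ∀ v {a b : ℝ}, 0 ≤ a → a ≤ b → b ≤ T → IntervalIntegrable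
      (fun r => ∑ j, (-ν * ⟪D j (g r), D j v⟫ + ⟪J (f j r), D j v⟫)) volume a b := by
    intro v a b ha hab hb
    refine ContinuousOn.intervalIntegrable_of_Icc hab ((hcont v).mono (Icc_subset_Icc ha hb))
  -- the regularised solution is Lipschitz in time
  set B : ℝ := ∑ j, (ν * (‖D j‖ * M) * ‖D j‖ + M * ‖D j‖) with hB
  have hB0 : 0 ≤ B := Finset.sum_nonneg fun j _ => by positivity
  have hlip : ∀ a b, 0 ≤ a → a ≤ b → b ≤ T → ‖J (J (g b)) - J (J (g a))‖ ≤ B * (b - a) := by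
    intro a b ha hab hb
    set δ := J (J (g b)) - J (J (g a)) with hδ
    have h1 : ⟪J (g b) - J (g a), J δ⟫ = ‖δ‖ ^ 2 := by
      rw [← hJ, map_sub, ← hδ, real_inner_self_eq_norm_sq]
    have h2 : ‖∫ r in a..b, ∑ j, (-ν * ⟪D j (g r), D j δ⟫ + ⟪J (f j r), D j δ⟫)‖
        ≤ B * ‖δ‖ * |b - a| := by
      refine intervalIntegral.norm_integral_le_of_norm_le_const fun r hr => ?_
      rw [uIoc_of_le hab] at hr
      have hr' : r ∈ Icc 0 T := ⟨ha.trans hr.1.le, hr.2.trans hb⟩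
      rw [hB, Finset.sum_mul]
      refine (norm_sum_le _ _).trans (Finset.sum_le_sum fun j _ => ?_)
      have e1 : ‖⟪D j (g r), D j δ⟫‖ ≤ (‖D j‖ * M) * (‖D j‖ * ‖δ‖) :=
        (norm_inner_le_norm _ _).trans (mul_le_mul ((D j).le_opNorm_of_le (hgM r hr'))
          ((D j).le_opNorm _) (norm_nonneg _) (by positivity))
      have e2 : ‖⟪J (f j r), D j δ⟫‖ ≤ M * (‖D j‖ * ‖δ‖) :=
        (norm_inner_le_norm _ _).trans (mul_le_mul ((hJ1 _).trans (hfM j r hr'))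
          ((D j).le_opNorm _) (norm_nonneg _) hM)
      refine (norm_add_le _ _).trans ?_
      rw [norm_mul, norm_neg, Real.norm_of_nonneg hν.le]
      have := mul_le_mul_of_nonneg_left e1 hν.le
      linarith
    rw [← hid δ a b ha hab hb, h1, norm_pow, norm_norm, abs_of_nonneg (by linarith)] at h2
    rcases (norm_nonneg δ).eq_or_lt with h0 | h0
    · rw [← h0]; exact mul_nonneg hB0 (by linarith)
    · nlinarith
  set q : ι → ℝ → H := fun j r => D j (J (J (g r))) with hq
  have hqlip : ∀ j a b, 0 ≤ a → a ≤ b → b ≤ T → ‖q j b - q j a‖ ≤ ‖D j‖ * (B * (b - a)) := by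
    intro j a b ha hab hb
    simp only [hq]
    rw [← map_sub]
    exact (D j).le_opNorm_of_le (hlip a b ha hab hb)
  set C : ℝ := ∑ j, (ν * (‖D j‖ * M) + M) * (2 * (‖D j‖ * B)) with hC
  have hJJ : ∀ v, ‖J (J v)‖ ≤ ‖v‖ := fun v => (hJ1 _).trans (hJ1 _)
  -- The test vector J⁴(g_a + g_b) is the one producing the increment of ‖J³g‖² over [a, b]. Its
  -- integrand is compared with the value obtained by freezing the test vector at time r, up to an
  -- error of order b - a.
  have hpt : ∀ a b r, 0 ≤ a → a ≤ r → r ≤ b → b ≤ T →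
      ∑ j, (-ν * ⟪D j (g r), D j (J (J (J (J (g a + g b)))))⟫
        + ⟪J (f j r), D j (J (J (J (J (g a + g b)))))⟫)
      ≤ (2 * ν)⁻¹ * (∑ j, ‖f j r‖ ^ 2) + C * (b - a) := by
    intro a b r ha har hrb hb
    have hr' : r ∈ Icc 0 T := ⟨ha.trans har, hrb.trans hb⟩
    rw [hC, Finset.mul_sum, Finset.sum_mul, ← Finset.sum_add_distrib]
    refine Finset.sum_le_sum fun j _ => ?_
    have hD4 : D j (J (J (J (J (g a + g b))))) = J (J (q j a + q j b)) := by
      simp only [hq, ← map_add, hJD]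
    -- As q is Lipschitz, q_a + q_b differs from 2 q_r by O(b - a).
    have hsplit : q j a + q j b = (2 : ℝ) • q j r + ((q j a - q j r) + (q j b - q j r)) := by
      rw [two_smul]; abel
    set w := (q j a - q j r) + (q j b - q j r) with hw
    have hwn : ‖w‖ ≤ 2 * (‖D j‖ * B) * (b - a) := by
      have e1 := hqlip j a r ha har (hrb.trans hb)
      have e2 := hqlip j r b (ha.trans har) hrb hb
      rw [norm_sub_rev] at e1
      have e3 := norm_add_le (q j a - q j r) (q j b - q j r)
      have e4 : 0 ≤ ‖D j‖ * B := by positivity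
      nlinarith
    have i1 : ⟪D j (g r), D j (J (J (J (J (g a + g b)))))⟫ = ⟪q j r, q j a + q j b⟫ := by
      rw [hD4, ← hJ, ← hJ, hJD, hJD]
    have i2 : ⟪J (f j r), D j (J (J (J (J (g a + g b)))))⟫
        = ⟪J (J (J (f j r))), q j a + q j b⟫ := by
      rw [hD4, ← hJ, ← hJ]
    have hqn : ‖q j r‖ ≤ ‖D j‖ * M := (D j).le_opNorm_of_le ((hJJ _).trans (hgM r hr'))
    have hFn : ‖J (J (J (f j r)))‖ ≤ ‖f j r‖ := (hJJ _).trans (hJ1 _)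
    set F := J (J (J (f j r))) with hF
    clear_value w
    rw [i1, i2, hsplit, inner_add_right, inner_add_right, inner_smul_right, inner_smul_right,
      real_inner_self_eq_norm_sq]
    have j1 : -⟪q j r, w⟫ ≤ (‖D j‖ * M) * (2 * (‖D j‖ * B) * (b - a)) :=
      (neg_le_abs _).trans ((abs_real_inner_le_norm _ _).trans
        (mul_le_mul hqn hwn (norm_nonneg _) (by positivity)))
    have j2 : ⟪F, w⟫ ≤ M * (2 * (‖D j‖ * B) * (b - a)) :=
      (real_inner_le_norm _ _).trans
        (mul_le_mul (hFn.trans (hfM j r hr')) hwn (norm_nonneg _) hM)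
    have j3 : ⟪F, q j r⟫ ≤ ‖f j r‖ * ‖q j r‖ :=
      (real_inner_le_norm _ _).trans (mul_le_mul_of_nonneg_right hFn (norm_nonneg _))
    -- Young's inequality, weighted so that 2ν‖q‖² is exactly the available dissipation; this fixes
    -- the constant 1/(2ν).
    have j4 : 2 * (‖f j r‖ * ‖q j r‖) ≤ (2 * ν)⁻¹ * ‖f j r‖ ^ 2 + 2 * ν * ‖q j r‖ ^ 2 := by
      have := sq_nonneg (‖f j r‖ - 2 * ν * ‖q j r‖)
      have e : (2 * ν)⁻¹ * ‖f j r‖ ^ 2 + 2 * ν * ‖q j r‖ ^ 2 - 2 * (‖f j r‖ * ‖q j r‖)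
          = (2 * ν)⁻¹ * (‖f j r‖ - 2 * ν * ‖q j r‖) ^ 2 := by field_simp; ring
      have : 0 ≤ (2 * ν)⁻¹ * (‖f j r‖ - 2 * ν * ‖q j r‖) ^ 2 := by positivity
      linarith
    have j5 := mul_le_mul_of_nonneg_left j1 hν.le
    linarith
  set φ : ℝ → ℝ := fun r => ‖J (J (J (g r)))‖ ^ 2 - (2 * ν)⁻¹ * ∫ y in s..r, k y with hφ
  have hmono : φ t ≤ φ s := by
    refine le_of_sub_le_mul_sq (C := C) hst fun a b hsa hab hbt => ?_
    have ha : 0 ≤ a := hs.trans hsa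
    have hb : b ≤ T := hbt.trans ht
    -- The difference of squares ⟪b - a, b + a⟫, with five of the six factors J moved to the right.
    have hE : ‖J (J (J (g b)))‖ ^ 2 - ‖J (J (J (g a)))‖ ^ 2
        = ⟪J (g b) - J (g a), J (J (J (J (J (g a + g b)))))⟫ := by
      rw [← hJ, ← hJ]
      simp only [map_sub, map_add, inner_sub_left, inner_add_right, ← real_inner_self_eq_norm_sq,
        hJ]
      rw [real_inner_comm (J (J (J (J (J (J (g a))))))) (g b)]
      simp only [← hJ]
      ring
    have hI : ∫ r in a..b, ∑ j, (-ν * ⟪D j (g r), D j (J (J (J (J (g a + g b)))))⟫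
        + ⟪J (f j r), D j (J (J (J (J (g a + g b)))))⟫)
        ≤ ∫ r in a..b, ((2 * ν)⁻¹ * k r + C * (b - a)) := by
      refine intervalIntegral.integral_mono_on hab (hint _ ha hab hb)
        (Continuous.intervalIntegrable (by fun_prop) _ _) fun r hr => ?_
      refine (hpt a b r ha hr.1 hr.2 hb).trans ?_
      have := hfk r ⟨hsa.trans hr.1, hr.2.trans hbt⟩
      gcongr
    rw [← hid _ a b ha hab hb, ← hE, intervalIntegral.integral_add
      (Continuous.intervalIntegrable (by fun_prop) _ _) (by simp),
      intervalIntegral.integral_const_mul, intervalIntegral.integral_const, smul_eq_mul] at hI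
    have hadd := intervalIntegral.integral_add_adjacent_intervals
      (hk.intervalIntegrable (μ := volume) s a) (hk.intervalIntegrable (μ := volume) a b)
    simp only [hφ]
    rw [← hadd]
    linarith
  simp only [hφ, intervalIntegral.integral_same] at hmono
  linarith

end

/-! ### Test functions and their convolution -/

section TestSpace

/-- Smooth compactly supported real functions. -/
def testSpace (V : Type*) [NormedAddCommGroup V] [NormedSpace ℝ V] : Submodule ℝ (V → ℝ) where
  carrier := {ψ | ContDiff ℝ ∞ ψ ∧ HasCompactSupport ψ}
  add_mem' h₁ h₂ := ⟨h₁.1.add h₂.1, h₁.2.add h₂.2⟩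
  zero_mem' := ⟨contDiff_const, HasCompactSupport.zero⟩
  smul_mem' c _ h := ⟨contDiff_const.smul h.1, h.2.smul_left (f := fun _ => c)⟩

variable {V : Type*} [NormedAddCommGroup V] [NormedSpace ℝ V]

namespace testSpace

/-- The directional derivative of a test function. -/
noncomputable def dirDeriv (e : V) (ψ : testSpace V) : testSpace V :=
  ⟨fun x => fderiv ℝ (ψ : V → ℝ) x e, by
    have h : ContDiff ℝ ∞ (fderiv ℝ (ψ : V → ℝ)) := ψ.2.1.fderiv_right (m := ∞) (by simp)
    exact h.clm_apply contDiff_const, by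
    have h := (ψ.2.2 : HasCompactSupport (ψ : V → ℝ)).fderiv_apply ℝ e
    exact h⟩

variable [MeasurableSpace V] [BorelSpace V] [FiniteDimensional ℝ V] {μ : Measure V}
  [μ.IsAddHaarMeasure]

theorem memLp (ψ : testSpace V) (p : ℝ≥0∞) : MemLp (ψ : V → ℝ) p μ :=
  ψ.2.1.continuous.memLp_of_hasCompactSupport ψ.2.2

variable (μ) in
/-- The class in `L²` of a test function. -/
noncomputable def toL2 : testSpace V →ₗ[ℝ] Lp ℝ 2 μ where
  toFun ψ := (memLp ψ 2).toLp _
  map_add' _ _ := rfl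
  map_smul' _ _ := rfl

theorem coeFn_toL2 (ψ : testSpace V) : (toL2 μ ψ : V → ℝ) =ᵐ[μ] ψ := (memLp ψ 2).coeFn_toLp

theorem denseRange_toL2 : DenseRange (toL2 μ : testSpace V → Lp ℝ 2 μ) := by
  refine (Lp.dense_hasCompactSupport_contDiff (F := ℝ) (μ := μ) (p := 2) (by simp)).mono ?_
  rintro f ⟨g, hfg, hg1, hg2⟩
  refine ⟨⟨g, hg2, hg1⟩, Lp.ext ?_⟩
  exact (coeFn_toL2 _).trans hfg.symm

theorem _root_.L2_real_inner_eq_integral {α : Type*} [MeasurableSpace α] {m : Measure α}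
    (v w : Lp ℝ 2 m) : ⟪v, w⟫ = ∫ x, v x * w x ∂m := by
  rw [L2.inner_def]
  refine integral_congr_ae (Filter.Eventually.of_forall fun x => ?_)
  simp [mul_comm]

theorem inner_toL2 (v : Lp ℝ 2 μ) (ψ : testSpace V) : ⟪v, toL2 μ ψ⟫ = ∫ x, v x * ψ.1 x ∂μ := by
  rw [L2_real_inner_eq_integral]
  refine integral_congr_ae ?_
  filter_upwards [coeFn_toL2 (μ := μ) ψ] with x hx
  rw [hx]

variable (μ) in
/-- Convolution of test functions. -/
noncomputable def conv (ρ ψ : testSpace V) : testSpace V :=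
  ⟨convolution ρ ψ (ContinuousLinearMap.lsmul ℝ ℝ) μ,
    HasCompactSupport.contDiff_convolution_right (n := ⊤) _ ψ.2.2
      ρ.2.1.continuous.locallyIntegrable ψ.2.1,
    HasCompactSupport.convolution _ ρ.2.2 ψ.2.2⟩

theorem conv_apply (ρ ψ : testSpace V) (x : V) :
    (conv μ ρ ψ : V → ℝ) x = ∫ a, ρ.1 a * ψ.1 (x - a) ∂μ := rfl

theorem dirDeriv_conv_right (e : V) (ρ ψ : testSpace V) :
    dirDeriv e (conv μ ρ ψ) = conv μ ρ (dirDeriv e ψ) := by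
  refine Subtype.ext (funext fun x => ?_)
  have h := HasCompactSupport.hasFDerivAt_convolution_right (μ := μ)
    (ContinuousLinearMap.lsmul ℝ ℝ) ψ.2.2 ρ.2.1.continuous.locallyIntegrable
    (ψ.2.1.of_le (by simp)) x
  change fderiv ℝ (convolution ρ.1 ψ.1 (ContinuousLinearMap.lsmul ℝ ℝ) μ) x e = _
  rw [h.fderiv]
  exact convolution_precompR_apply (ContinuousLinearMap.lsmul ℝ ℝ)
    ρ.2.1.continuous.locallyIntegrable (HasCompactSupport.fderiv ℝ ψ.2.2)
    (ψ.2.1.continuous_fderiv (by simp)) x e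

theorem conv_comm (ρ ψ : testSpace V) : conv μ ρ ψ = conv μ ψ ρ := by
  refine Subtype.ext (funext fun x => ?_)
  rw [conv_apply, conv_apply, ← integral_sub_left_eq_self _ μ x]
  simp only [sub_sub_cancel, mul_comm]

theorem dirDeriv_conv_left (e : V) (ρ ψ : testSpace V) :
    dirDeriv e (conv μ ρ ψ) = conv μ (dirDeriv e ρ) ψ := by
  rw [conv_comm, dirDeriv_conv_right, conv_comm]

end testSpace

end TestSpace

/-! ### Convolution operators on L² -/

section Mollify

variable {V : Type*} [NormedAddCommGroup V] [NormedSpace ℝ V] [MeasurableSpace V] [BorelSpace V]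
  [FiniteDimensional ℝ V] {μ : Measure V} [μ.IsAddHaarMeasure]

open testSpace

/-- Translation by `a` on `L²`. -/
noncomputable def translateL2 (a : V) : Lp ℝ 2 μ →ₗᵢ[ℝ] Lp ℝ 2 μ :=
  Lp.compMeasurePreservingₗᵢ ℝ (fun x => x - a) (measurePreserving_sub_right μ a)

theorem coeFn_translateL2 (a : V) (v : Lp ℝ 2 μ) :
    (translateL2 a v : V → ℝ) =ᵐ[μ] fun x => v (x - a) :=
  Lp.coeFn_compMeasurePreserving v (measurePreserving_sub_right μ a)

theorem translateL2_translateL2 (a b : V) (v : Lp ℝ 2 μ) :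
    translateL2 a (translateL2 b v) = translateL2 (a + b) v := by
  refine Lp.ext ?_
  have h := (measurePreserving_sub_right μ a).quasiMeasurePreserving.ae_eq_comp
    (coeFn_translateL2 b v)
  filter_upwards [coeFn_translateL2 a (translateL2 b v), coeFn_translateL2 (a + b) v, h]
    with x h1 h2 h3
  rw [h1, h2]
  simp only [Function.comp_apply] at h3
  rw [h3, sub_sub]

theorem translateL2_zero (v : Lp ℝ 2 μ) : translateL2 0 v = v := by
  refine Lp.ext ?_
  filter_upwards [coeFn_translateL2 0 v] with x h1
  rw [h1, sub_zero]

theorem continuous_translateL2 (v : Lp ℝ 2 μ) : Continuous fun a => translateL2 a v := by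
  let G : C(V, C(V, V)) := ContinuousMap.curry ⟨fun p : V × V => p.2 - p.1, by fun_prop⟩
  exact Continuous.compMeasurePreservingLp (Z := V) (f := fun _ => v) (g := fun a => G a)
    continuous_const G.continuous (fun a => measurePreserving_sub_right μ a) (by simp)

theorem inner_translateL2 (a : V) (v w : Lp ℝ 2 μ) :
    ⟪translateL2 a v, w⟫ = ⟪v, translateL2 (-a) w⟫ := by
  conv_lhs => rw [← translateL2_zero w, ← add_neg_cancel a, ← translateL2_translateL2]
  exact (translateL2 a).inner_map_map _ _

theorem integrable_smul_translateL2 (ρ : testSpace V) (v : Lp ℝ 2 μ) :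
    Integrable (fun a => (ρ : V → ℝ) a • translateL2 a v) μ :=
  (ρ.2.1.continuous.smul (continuous_translateL2 v)).integrable_of_hasCompactSupport
    ρ.2.2.smul_right

variable (μ) in
/-- Convolution with a test function, as an operator on `L²`. -/
noncomputable def mollify (ρ : testSpace V) : Lp ℝ 2 μ →L[ℝ] Lp ℝ 2 μ :=
  LinearMap.mkContinuous
    { toFun := fun v => ∫ a, (ρ : V → ℝ) a • translateL2 a v ∂μ
      map_add' := fun v w => by
        simp only [map_add, smul_add]
        exact integral_add (integrable_smul_translateL2 ρ v) (integrable_smul_translateL2 ρ w)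
      map_smul' := fun c v => by
        simp only [map_smul, RingHom.id_apply]
        rw [← integral_smul]
        simp only [smul_comm c] }
    (∫ a, ‖(ρ : V → ℝ) a‖ ∂μ) fun v => by
      refine (norm_integral_le_integral_norm _).trans_eq ?_
      simp only [norm_smul, LinearIsometry.norm_map]
      exact integral_mul_const _ _

theorem mollify_apply (ρ : testSpace V) (v : Lp ℝ 2 μ) :
    mollify μ ρ v = ∫ a, (ρ : V → ℝ) a • translateL2 a v ∂μ := rfl

theorem norm_mollify_le (ρ : testSpace V) (v : Lp ℝ 2 μ) :
    ‖mollify μ ρ v‖ ≤ (∫ a, ‖(ρ : V → ℝ) a‖ ∂μ) * ‖v‖ := by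
  refine (norm_integral_le_integral_norm _).trans_eq ?_
  simp only [norm_smul, LinearIsometry.norm_map]
  exact integral_mul_const _ _

theorem mollify_translateL2 (ρ : testSpace V) (b : V) (v : Lp ℝ 2 μ) :
    mollify μ ρ (translateL2 b v) = translateL2 b (mollify μ ρ v) := by
  have := (translateL2 (μ := μ) b).toContinuousLinearMap.integral_comp_comm
    (integrable_smul_translateL2 ρ v)
  rw [mollify_apply, mollify_apply]
  refine Eq.trans (integral_congr_ae (Filter.Eventually.of_forall fun a => ?_)) this
  simp only [LinearIsometry.coe_toContinuousLinearMap, map_smul, translateL2_translateL2,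
    add_comm a b]

/-- Both operators are averages of translations, and translations commute. -/
theorem mollify_comm (ρ σ : testSpace V) (v : Lp ℝ 2 μ) :
    mollify μ ρ (mollify μ σ v) = mollify μ σ (mollify μ ρ v) := by
  have := (mollify μ ρ).integral_comp_comm (integrable_smul_translateL2 σ v)
  rw [mollify_apply σ v, ← this, mollify_apply σ]
  simp only [map_smul, mollify_translateL2]

/-- Translation by a has adjoint translation by -a, so the parity of ρ decides: c = 1 gives a
self-adjoint operator, c = -1 (the derivative of an even ρ) a skew-adjoint one. -/
theorem inner_mollify {ρ : testSpace V} {c : ℝ} (hρ : ∀ a, (ρ : V → ℝ) (-a) = c * (ρ : V → ℝ) a)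
    (v w : Lp ℝ 2 μ) : ⟪mollify μ ρ v, w⟫ = c * ⟪v, mollify μ ρ w⟫ := by
  rw [mollify_apply, mollify_apply, ← integral_inner (integrable_smul_translateL2 ρ w),
    real_inner_comm, ← integral_inner (integrable_smul_translateL2 ρ v), ← integral_const_mul,
    ← integral_neg_eq_self]
  refine integral_congr_ae (Filter.Eventually.of_forall fun a => ?_)
  simp only [inner_smul_right, hρ]
  rw [real_inner_comm, inner_translateL2, neg_neg]
  ring

/-- Fubini, after pairing with a test function; by density such pairings determine the class. -/
theorem mollify_toL2 (ρ ψ : testSpace V) : mollify μ ρ (toL2 μ ψ) = toL2 μ (conv μ ρ ψ) := by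
  refine (denseRange_toL2 (V := V) (μ := μ)).eq_of_inner_left ℝ ?_
  intro w
  rw [real_inner_comm, real_inner_comm (toL2 μ w), mollify_apply,
    ← integral_inner (integrable_smul_translateL2 ρ _), real_inner_comm, inner_toL2]
  have h1 : ∀ a, ⟪toL2 μ w, (ρ : V → ℝ) a • translateL2 a (toL2 μ ψ)⟫
      = ∫ x, ρ.1 a * ψ.1 (x - a) * w.1 x ∂μ := by
    intro a
    rw [inner_smul_right, real_inner_comm, inner_toL2, ← integral_const_mul]
    refine integral_congr_ae ?_
    have h := (measurePreserving_sub_right μ a).quasiMeasurePreserving.ae_eq_comp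
      (coeFn_toL2 (μ := μ) ψ)
    filter_upwards [coeFn_translateL2 a (toL2 μ ψ), h] with x h2 h3
    simp only [Function.comp_apply] at h3
    rw [h2, h3, mul_assoc]
  have h2 : ∫ x, (toL2 μ (conv μ ρ ψ) : V → ℝ) x * w.1 x ∂μ
      = ∫ x, ∫ a, ρ.1 a * ψ.1 (x - a) * w.1 x ∂μ ∂μ := by
    refine integral_congr_ae ?_
    filter_upwards [coeFn_toL2 (μ := μ) (conv μ ρ ψ)] with x hx
    rw [hx, conv_apply, integral_mul_const]
  simp only [h1]
  rw [h2]
  refine integral_integral_swap ?_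
  refine Continuous.integrable_of_hasCompactSupport ?_ ?_
  · have := ρ.2.1.continuous; have := ψ.2.1.continuous; have := w.2.1.continuous
    simp only [Function.uncurry_def]
    fun_prop
  · refine HasCompactSupport.intro (ρ.2.2.isCompact.prod
      w.2.2.isCompact) fun p hp => ?_
    rw [mem_prod, not_and_or] at hp
    rcases hp with hp | hp
    · simp [Function.uncurry, image_eq_zero_of_notMem_tsupport hp]
    · simp [Function.uncurry, image_eq_zero_of_notMem_tsupport hp]

end Mollify

/-! ### Energy inequality for weak evolutions in L² -/

section Energy

variable {V : Type*} [NormedAddCommGroup V] [NormedSpace ℝ V] [MeasurableSpace V] [BorelSpace V]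
  [FiniteDimensional ℝ V] {μ : Measure V} [μ.IsAddHaarMeasure]

open testSpace Filter Topology

variable (V μ) in
/-- An even approximate identity made of test functions. -/
theorem exists_even_mollifier : ∃ ρ : ℕ → testSpace V,
    (∀ n a, (ρ n : V → ℝ) (-a) = (ρ n : V → ℝ) a) ∧
    (∀ n v, ‖mollify μ (ρ n) v‖ ≤ ‖v‖) ∧
    ∀ v, Tendsto (fun n => mollify μ (ρ n) v) atTop (𝓝 v) := by
  let φ : ℕ → ContDiffBump (0 : V) := fun n =>
    ⟨1 / ((n : ℝ) + 1) / 2, 1 / ((n : ℝ) + 1), by positivity, half_lt_self (by positivity)⟩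
  refine ⟨fun n => ⟨(φ n).normed μ, (φ n).contDiff_normed, (φ n).hasCompactSupport_normed⟩,
    fun n a => (φ n).normed_neg a, fun n v => ?_, fun v => ?_⟩
  · refine (norm_mollify_le _ v).trans_eq ?_
    have : ∫ a, ‖(φ n).normed μ a‖ ∂μ = 1 := by
      rw [← (φ n).integral_normed (μ := μ)]
      exact integral_congr_ae (.of_forall fun a => Real.norm_of_nonneg ((φ n).nonneg_normed a))
    change (∫ a, ‖(φ n).normed μ a‖ ∂μ) * ‖v‖ = ‖v‖
    rw [this, one_mul]
  -- The mollification of v is the convolution at the origin of the bump with the continuous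
  -- L²-valued map a ↦ v(· + a), whose value at 0 is v.
  · have h := ContDiffBump.convolution_tendsto_right_of_continuous (μ := μ) (φ := φ) (l := atTop)
      (g := fun a => translateL2 (-a) v) tendsto_one_div_add_atTop_nhds_zero_nat
      ((continuous_translateL2 v).comp continuous_neg) 0
    rw [neg_zero, translateL2_zero] at h
    refine h.congr fun n => ?_
    simp only [convolution_def, zero_sub, neg_neg, ContinuousLinearMap.lsmul_apply]
    rfl

theorem dirDeriv_neg_of_even {ρ : testSpace V} (hρ : ∀ a, (ρ : V → ℝ) (-a) = (ρ : V → ℝ) a)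
    (e a : V) : (dirDeriv e ρ).1 (-a) = (-1) * (dirDeriv e ρ).1 a := by
  change fderiv ℝ ρ.1 (-a) e = (-1) * fderiv ℝ ρ.1 a e
  have h : (fun x => ρ.1 (-x)) = ρ.1 := funext hρ
  have hd : DifferentiableAt ℝ ρ.1 (-a) := (ρ.2.1.differentiable (by simp)) _
  have h2 : HasFDerivAt (fun x => ρ.1 (-x)) _ a := hd.hasFDerivAt.comp a (hasFDerivAt_id a).neg
  rw [h] at h2
  rw [h2.fderiv]
  simp

/-- The weak form, tested with smooth compactly supported functions, of
`∂_t g + ∑_j ∂_j f_j = ν ∑_j ∂_j² g`, for curves in `L²` that are weakly continuous on `[0, T]`. -/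
structure IsWeakEvolution {ι : Type*} [Fintype ι] (e : ι → V) (T ν M : ℝ) (g : ℝ → Lp ℝ 2 μ)
    (f : ι → ℝ → Lp ℝ 2 μ) : Prop where
  norm_le : ∀ t ∈ Icc 0 T, ‖g t‖ ≤ M
  norm_flux_le : ∀ j, ∀ t ∈ Icc 0 T, ‖f j t‖ ≤ M
  weak_cont : ∀ v, ContinuousOn (fun t => ⟪g t, v⟫) (Icc 0 T)
  weak_cont_flux : ∀ j v, ContinuousOn (fun t => ⟪f j t, v⟫) (Icc 0 T)
  evolution : ∀ (ψ : testSpace V) s t, 0 ≤ s → s ≤ t → t ≤ T →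
    ⟪g t - g s, toL2 μ ψ⟫ = ∫ r in s..t, ∑ j,
      (ν * ⟪g r, toL2 μ (dirDeriv (e j) (dirDeriv (e j) ψ))⟫
        + ⟪f j r, toL2 μ (dirDeriv (e j) ψ)⟫)

namespace IsWeakEvolution

variable {ι : Type*} [Fintype ι] {e : ι → V} {T ν M : ℝ} {g : ℝ → Lp ℝ 2 μ}
  {f : ι → ℝ → Lp ℝ 2 μ}

/-- For v a test function ψ, this is the weak form tested with ρ ∗ ρ ∗ ψ, one ρ or ∂_jρ being moved
onto the solution. Both sides are continuous in v, so density of test functions suffices. -/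
theorem mollified (h : IsWeakEvolution e T ν M g f) {ρ : testSpace V}
    (hρ : ∀ a, (ρ : V → ℝ) (-a) = (ρ : V → ℝ) a) (v : Lp ℝ 2 μ) {s t : ℝ} (hs : 0 ≤ s)
    (hst : s ≤ t) (ht : t ≤ T) :
    ⟪mollify μ ρ (g t) - mollify μ ρ (g s), mollify μ ρ v⟫ = ∫ r in s..t, ∑ j,
      (-ν * ⟪mollify μ (dirDeriv (e j) ρ) (g r), mollify μ (dirDeriv (e j) ρ) v⟫
        + ⟪mollify μ ρ (f j r), mollify μ (dirDeriv (e j) ρ) v⟫) := by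
  have hJ : ∀ v w : Lp ℝ 2 μ, ⟪mollify μ ρ v, w⟫ = ⟪v, mollify μ ρ w⟫ := fun v w => by
    rw [inner_mollify (c := 1) (by simpa using hρ), one_mul]
  have hD : ∀ j (v w : Lp ℝ 2 μ), ⟪mollify μ (dirDeriv (e j) ρ) v, w⟫
      = -⟪v, mollify μ (dirDeriv (e j) ρ) w⟫ := fun j v w => by
    rw [inner_mollify (dirDeriv_neg_of_even hρ (e j)), neg_one_mul]
  have hM : 0 ≤ M := (norm_nonneg _).trans (h.norm_le s ⟨hs, hst.trans ht⟩)
  set J := mollify μ ρ with hJdef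
  set D : ι → Lp ℝ 2 μ →L[ℝ] Lp ℝ 2 μ := fun j => mollify μ (dirDeriv (e j) ρ) with hDdef
  change ⟪J (g t) - J (g s), J v⟫ = ∫ r in s..t, ∑ j, (-ν * ⟪D j (g r), D j v⟫
    + ⟪J (f j r), D j v⟫)
  have hJ' : ∀ v w, ⟪J v, w⟫ = ⟪v, J w⟫ := hJ
  have hD' : ∀ j v w, ⟪D j v, w⟫ = -⟪v, D j w⟫ := hD
  have hcont : Continuous fun v => ∫ r in s..t, ∑ j, (-ν * ⟪D j (g r), D j v⟫
      + ⟪J (f j r), D j v⟫) := by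
    refine continuous_iff_continuousAt.2 fun v₀ => ?_
    set R := ‖v₀‖ + 1 with hR
    refine intervalIntegral.continuousAt_of_dominated_interval
      (bound := fun _ => ∑ j, (|ν| * (‖D j‖ * M) * (‖D j‖ * R) + (‖J‖ * M) * (‖D j‖ * R)))
      ?_ ?_ (by simp) ?_
    · refine .of_forall fun v => ?_
      have hc : ContinuousOn (fun r => ∑ j, (-ν * ⟪D j (g r), D j v⟫ + ⟪J (f j r), D j v⟫))
          (Icc 0 T) := by
        refine continuousOn_finsetSum _ fun j _ => ?_
        simp only [hD', hJ']
        exact (continuousOn_const.mul (h.weak_cont _).neg).add (h.weak_cont_flux j _)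
      rw [uIoc_of_le hst]
      exact (hc.mono fun r hr => ⟨hs.trans hr.1.le, hr.2.trans ht⟩).aestronglyMeasurable
        measurableSet_Ioc
    · filter_upwards [Metric.ball_mem_nhds v₀ one_pos] with v hv
      refine .of_forall fun r hr => ?_
      rw [uIoc_of_le hst] at hr
      have hr' : r ∈ Icc 0 T := ⟨hs.trans hr.1.le, hr.2.trans ht⟩
      have hvR : ‖v‖ ≤ R := by
        have := norm_le_norm_add_norm_sub' v v₀
        rw [mem_ball_iff_norm] at hv
        linarith
      refine (norm_sum_le _ _).trans (Finset.sum_le_sum fun j _ => (norm_add_le _ _).trans ?_)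
      rw [norm_mul, norm_neg, Real.norm_eq_abs ν, mul_assoc]
      have hDv := (D j).le_opNorm_of_le hvR
      gcongr
      · exact (norm_inner_le_norm _ _).trans (mul_le_mul
          ((D j).le_opNorm_of_le (h.norm_le r hr')) hDv (norm_nonneg _) (by positivity))
      · exact (norm_inner_le_norm _ _).trans (mul_le_mul
          (J.le_opNorm_of_le (h.norm_flux_le j r hr')) hDv (norm_nonneg _) (by positivity))
    · exact .of_forall fun r _ => Continuous.continuousAt (by fun_prop)
  refine denseRange_toL2.induction_on (p := fun v => ⟪J (g t) - J (g s), J v⟫ = ∫ r in s..t, ∑ j,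
    (-ν * ⟪D j (g r), D j v⟫ + ⟪J (f j r), D j v⟫)) v (isClosed_eq (by fun_prop) hcont) fun ψ => ?_
  have hJψ : ∀ χ, J (toL2 μ χ) = toL2 μ (conv μ ρ χ) := mollify_toL2 ρ
  have hDψ : ∀ j χ, D j (toL2 μ χ) = toL2 μ (conv μ (dirDeriv (e j) ρ) χ) :=
    fun j χ => mollify_toL2 _ χ
  rw [← map_sub, hJ', hJψ, hJψ, h.evolution _ s t hs hst ht]
  congr 1
  funext r
  refine Finset.sum_congr rfl fun j _ => ?_
  have e1 : toL2 μ (dirDeriv (e j) (conv μ ρ (conv μ ρ ψ))) = J (D j (toL2 μ ψ)) := by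
    rw [hDψ, hJψ, dirDeriv_conv_right, dirDeriv_conv_left]
  have e2 : toL2 μ (dirDeriv (e j) (dirDeriv (e j) (conv μ ρ (conv μ ρ ψ))))
      = D j (D j (toL2 μ ψ)) := by
    rw [hDψ, hDψ, dirDeriv_conv_left (e j) ρ (conv μ ρ ψ), dirDeriv_conv_right,
      dirDeriv_conv_left]
  rw [e1, e2, hD', hJ']
  ring

/-- Limit of the regularised inequality: the mollifiers are contractions converging strongly to the
identity, hence so do their cubes. -/
theorem energy_le (h : IsWeakEvolution e T ν M g f) (hν : 0 < ν) {s t : ℝ} (hs : 0 ≤ s)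
    (hst : s ≤ t) (ht : t ≤ T) {k : ℝ → ℝ} (hk : Continuous k)
    (hfk : ∀ r ∈ Icc s t, ∑ j, ‖f j r‖ ^ 2 ≤ k r) :
    ‖g t‖ ^ 2 ≤ ‖g s‖ ^ 2 + (2 * ν)⁻¹ * ∫ r in s..t, k r := by
  obtain ⟨ρ, hρ, hρ1, hρlim⟩ := exists_even_mollifier V μ
  have hlim : ∀ v : Lp ℝ 2 μ, Tendsto
      (fun n => ‖mollify μ (ρ n) (mollify μ (ρ n) (mollify μ (ρ n) v))‖ ^ 2) atTop
      (𝓝 (‖v‖ ^ 2)) := by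
    intro v
    have step : ∀ u : ℕ → Lp ℝ 2 μ, Tendsto u atTop (𝓝 v) →
        Tendsto (fun n => mollify μ (ρ n) (u n)) atTop (𝓝 v) := by
      intro u hu
      have h1 : Tendsto (fun n => mollify μ (ρ n) (u n - v)) atTop (𝓝 0) := by
        refine squeeze_zero_norm (fun n => hρ1 n _) ?_
        simpa using (hu.sub_const v).norm
      simpa [map_sub] using h1.add (hρlim v)
    exact ((step _ (step _ (hρlim v))).norm).pow 2
  refine le_of_tendsto_of_tendsto' (hlim (g t)) ((hlim (g s)).add_const _) fun n => ?_
  refine energy_le_of_regularization hν (mollify μ (ρ n))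
    (fun j => mollify μ (dirDeriv (e j) (ρ n))) (fun v w => ?_) (fun j v w => ?_)
    (fun j v => mollify_comm _ _ v) (hρ1 n) h.norm_le h.norm_flux_le h.weak_cont h.weak_cont_flux
    (fun v a b ha hab hb => h.mollified (hρ n) v ha hab hb) hs hst ht hk hfk
  · rw [inner_mollify (c := 1) (by simpa using hρ n), one_mul]
  · rw [inner_mollify (dirDeriv_neg_of_even (hρ n) (e j)), neg_one_mul]

end IsWeakEvolution

end Energy

/-! ### Weakly continuous versions -/

section WeakVersion

open Filter Topology

/-- The du Bois-Reymond lemma, with an initial datum. -/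
theorem ae_eq_add_integral_of_forall_test {T c : ℝ} (hT : 0 < T) {a w : ℝ → ℝ}
    (ha : IntegrableOn a (Icc 0 T)) (hw : IntegrableOn w (Icc 0 T))
    (h : ∀ η : ℝ → ℝ, ContDiff ℝ ∞ η → HasCompactSupport η → tsupport η ⊆ Iio T →
      (∫ t in Icc 0 T, (a t * deriv η t + w t * η t)) + c * η 0 = 0) :
    ∀ᵐ t ∂volume.restrict (Icc 0 T), a t = c + ∫ r in (0 : ℝ)..t, w r := by
  have hwi : IntervalIntegrable w volume 0 T :=
    (intervalIntegrable_iff_integrableOn_Icc_of_le hT.le).2 hw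
  set G : ℝ → ℝ := fun t => ∫ r in (0 : ℝ)..t, w r with hG
  have hGac : AbsolutelyContinuousOnInterval G 0 T :=
    hwi.absolutelyContinuousOnInterval_intervalIntegral left_mem_uIcc
  have hGc : ContinuousOn G (Icc 0 T) := by simpa [uIcc_of_le hT.le] using hGac.continuousOn
  have hGI : IntegrableOn (fun t => a t - (c + G t)) (Icc 0 T) :=
    ha.sub ((continuousOn_const.add hGc).integrableOn_Icc)
  have key : ∀ᵐ t : ℝ, t ∈ Ioo 0 T → a t - (c + G t) = 0 := by
    refine isOpen_Ioo.ae_eq_zero_of_integral_contDiff_smul_eq_zero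
      (hGI.mono_set Ioo_subset_Icc_self).locallyIntegrableOn fun ζ hζ hζc hζs => ?_
    obtain ⟨b, hb, hζb⟩ : ∃ b ∈ Ioo 0 T, ∀ t, b ≤ t → ζ t = 0 := by
      rcases (tsupport ζ).eq_empty_or_nonempty with he | hne
      · exact ⟨T / 2, ⟨by linarith, by linarith⟩, fun t _ =>
          image_eq_zero_of_notMem_tsupport (by simp [he])⟩
      · obtain ⟨m, hm, hmax⟩ := hζc.isCompact.exists_isMaxOn hne continuousOn_id
        have hm' := hζs hm
        refine ⟨(m + T) / 2, ⟨by linarith [hm'.1], by linarith [hm'.2]⟩, fun t ht =>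
          image_eq_zero_of_notMem_tsupport fun hts => ?_⟩
        have : t ≤ m := hmax hts
        linarith [hm'.2]
    -- This primitive vanishes on [b, ∞), but not necessarily at 0: P(0) = -∫ζ is what brings in the
    -- initial value c.
    set P : ℝ → ℝ := fun t => ∫ r in T..t, ζ r with hP
    have hζcont : Continuous ζ := hζ.continuous
    have hPd : ∀ t, HasDerivAt P (ζ t) t := fun t =>
      intervalIntegral.integral_hasDerivAt_right (hζcont.intervalIntegrable _ _)
        (hζcont.stronglyMeasurableAtFilter _ _) hζcont.continuousAt
    have hPderiv : deriv P = ζ := funext fun t => (hPd t).deriv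
    have hPs : ContDiff ℝ ∞ P := contDiff_infty_iff_deriv.2
      ⟨fun t => (hPd t).differentiableAt, by rwa [hPderiv]⟩
    have hPb : ∀ t, b ≤ t → P t = 0 := by
      intro t ht
      simp only [hP]
      rw [← intervalIntegral.integral_zero (a := T) (b := t) (μ := volume)]
      refine intervalIntegral.integral_congr fun r hr => hζb r ?_
      exact (le_min hb.2.le ht).trans hr.1
    -- The cutoff equals 1 on [0, T]; it only restores compact support on the negative axis.
    let χ : ContDiffBump (0 : ℝ) := ⟨T, T + 1, hT, by linarith⟩
    set η : ℝ → ℝ := fun t => χ t * P t with hη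
    have hηs : ContDiff ℝ ∞ η := χ.contDiff.mul hPs
    have hηc : HasCompactSupport η := χ.hasCompactSupport.mul_right
    have hηt : tsupport η ⊆ Iio T := by
      refine (closure_minimal ?_ isClosed_Iic).trans (Iic_subset_Iio.2 hb.2)
      intro t ht
      by_contra hbt
      exact ht (by simp [hη, hPb t (not_le.1 hbt).le])
    have hχ : ∀ t ∈ Icc 0 T, χ t = 1 := fun t ht => χ.one_of_mem_closedBall (by
      rw [mem_closedBall_zero_iff, Real.norm_eq_abs, abs_of_nonneg ht.1]; exact ht.2)
    have hηP : ∀ t ∈ Icc 0 T, η t = P t := fun t ht => by simp only [hη, hχ t ht, one_mul]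
    have hηd : ∀ t ∈ Ioo 0 T, deriv η t = ζ t := by
      intro t ht
      have : η =ᶠ[𝓝 t] P := by
        filter_upwards [Ioo_mem_nhds ht.1 ht.2] with r hr
        exact hηP r (Ioo_subset_Icc_self hr)
      rw [this.deriv_eq, hPderiv]
    have h1 := h η hηs hηc hηt
    have hPI : IntegrableOn (fun t => w t * P t) (Ioo 0 T) :=
      (hw.mul_continuousOn hPs.continuous.continuousOn isCompact_Icc).mono_set Ioo_subset_Icc_self
    have haI : IntegrableOn (fun t => a t * ζ t) (Ioo 0 T) :=
      (ha.mul_continuousOn hζcont.continuousOn isCompact_Icc).mono_set Ioo_subset_Icc_self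
    rw [integral_Icc_eq_integral_Ioo, setIntegral_congr_fun measurableSet_Ioo
      (g := fun t => a t * ζ t + w t * P t) (fun t ht => by
        simp only [hηd t ht, hηP t (Ioo_subset_Icc_self ht)]), integral_add haI hPI,
      hηP 0 ⟨le_rfl, hT.le⟩] at h1
    have hPT : P T = 0 := by simp [hP]
    have hPac : AbsolutelyContinuousOnInterval P 0 T :=
      (hPs.of_le (by simp)).contDiffOn.absolutelyContinuousOnInterval
    have h2 := hGac.integral_mul_deriv_eq_deriv_mul hPac
    have h3 : ∫ t in (0 : ℝ)..T, deriv G t * P t = ∫ t in (0 : ℝ)..T, w t * P t := by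
      refine intervalIntegral.integral_congr_ae ?_
      filter_upwards [hwi.ae_hasDerivAt_integral] with t ht ht'
      rw [(ht (uIoc_subset_uIcc ht') 0 left_mem_uIcc).deriv]
    have h4 : ∫ t in (0 : ℝ)..T, ζ t = - P 0 := by
      rw [hP, intervalIntegral.integral_symm]
    rw [hPderiv, h3, hPT, show G 0 = 0 by simp [hG], intervalIntegral.integral_of_le hT.le,
      intervalIntegral.integral_of_le hT.le, integral_Ioc_eq_integral_Ioo,
      integral_Ioc_eq_integral_Ioo] at h2
    rw [intervalIntegral.integral_of_le hT.le, integral_Ioc_eq_integral_Ioo] at h4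
    have hGζ' : IntegrableOn (fun t => G t * ζ t) (Ioo 0 T) :=
      ((hGc.mul hζcont.continuousOn).integrableOn_Icc).mono_set Ioo_subset_Icc_self
    have hζI : IntegrableOn (fun t => c * ζ t) (Ioo 0 T) :=
      ((continuous_const.mul hζcont).continuousOn.integrableOn_Icc).mono_set Ioo_subset_Icc_self
    have h5 : ∫ t in Ioo 0 T, ζ t • (a t - (c + G t)) = 0 := by
      have : ∀ t, ζ t • (a t - (c + G t)) = a t * ζ t - (c * ζ t + G t * ζ t) := fun t => by
        rw [smul_eq_mul]; ring
      simp only [this]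
      have hsum : IntegrableOn (fun t => c * ζ t + G t * ζ t) (Ioo 0 T) := hζI.add hGζ'
      rw [integral_sub haI hsum, integral_add hζI hGζ', integral_const_mul]
      linear_combination h1 - h2 - c * h4
    rw [← h5, setIntegral_eq_integral_of_forall_compl_eq_zero]
    intro t ht
    rw [image_eq_zero_of_notMem_tsupport fun hts => ht (hζs hts), zero_smul]
  rw [← Measure.restrict_congr_set Ioo_ae_eq_Icc, ae_restrict_iff' measurableSet_Ioo]
  filter_upwards [key] with t ht htm
  linarith [ht htm]

/-- A bounded curve in a Hilbert space whose pairings with a dense family have continuous versions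
has itself a weakly continuous version. -/
theorem exists_weaklyContinuous_version {E H : Type*} [AddCommGroup E] [Module ℝ E]
    [NormedAddCommGroup H] [InnerProductSpace ℝ H] [CompleteSpace H] [SecondCountableTopology H]
    {e : E →ₗ[ℝ] H} (he : DenseRange e) {T M : ℝ} (hT : 0 < T) (hM : 0 ≤ M) {U : ℝ → H}
    (hU : ∀ᵐ t ∂volume.restrict (Icc 0 T), ‖U t‖ ≤ M) {G : E → ℝ → ℝ}
    (hGc : ∀ ψ, ContinuousOn (G ψ) (Icc 0 T))
    (hG : ∀ ψ, ∀ᵐ t ∂volume.restrict (Icc 0 T), ⟪U t, e ψ⟫ = G ψ t) :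
    ∃ g : ℝ → H, (∀ t ∈ Icc 0 T, ‖g t‖ ≤ M) ∧
      (∀ v, ContinuousOn (fun t => ⟪g t, v⟫) (Icc 0 T)) ∧
      (∀ᵐ t ∂volume.restrict (Icc 0 T), g t = U t) ∧
      ∀ ψ, ∀ t ∈ Icc 0 T, ⟪g t, e ψ⟫ = G ψ t := by
  -- Almost everywhere identities between continuous functions hold at every time, so the dependence
  -- of the null sets on ψ does no harm.
  have hext : ∀ {φ φ' : ℝ → ℝ}, φ =ᵐ[volume.restrict (Icc 0 T)] φ' → ContinuousOn φ (Icc 0 T) →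
      ContinuousOn φ' (Icc 0 T) → EqOn φ φ' (Icc 0 T) := fun h1 h2 h3 =>
    Measure.eqOn_Icc_of_ae_eq volume hT.ne h1 h2 h3
  have hadd : ∀ ψ χ, ∀ t ∈ Icc 0 T, G (ψ + χ) t = G ψ t + G χ t := by
    intro ψ χ
    refine hext ?_ (hGc _) ((hGc _).add (hGc _))
    filter_upwards [hG ψ, hG χ, hG (ψ + χ)] with t h1 h2 h3
    rw [← h1, ← h2, ← h3, map_add, inner_add_right]
  have hsmul : ∀ (c : ℝ) ψ, ∀ t ∈ Icc 0 T, G (c • ψ) t = c • G ψ t := by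
    intro c ψ
    refine hext ?_ (hGc _) ((hGc _).const_smul c)
    filter_upwards [hG ψ, hG (c • ψ)] with t h1 h2
    rw [← h1, ← h2, map_smul, inner_smul_right, smul_eq_mul]
  have hbound : ∀ ψ, ∀ t ∈ Icc 0 T, ‖G ψ t‖ ≤ M * ‖e ψ‖ := by
    intro ψ t ht
    -- The inequality is written as an equality of continuous functions so that `hext` applies.
    have h0 : EqOn (fun t => max (‖G ψ t‖) (M * ‖e ψ‖)) (fun _ => M * ‖e ψ‖) (Icc 0 T) := by
      refine hext ?_ ((hGc ψ).norm.sup continuousOn_const) continuousOn_const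
      filter_upwards [hG ψ, hU] with t h1 h2
      rw [← h1]
      exact max_eq_right ((norm_inner_le_norm _ _).trans
        (mul_le_mul_of_nonneg_right h2 (norm_nonneg _)))
    exact max_eq_right_iff.1 (h0 ht)
  have hex : ∀ t ∈ Icc 0 T, ∃ x : H, ‖x‖ ≤ M ∧ ∀ ψ, ⟪x, e ψ⟫ = G ψ t := by
    intro t ht
    let F : E →ₗ[ℝ] ℝ :=
      { toFun := fun ψ => G ψ t
        map_add' := fun ψ χ => hadd ψ χ t ht
        map_smul' := fun c ψ => hsmul c ψ t ht }
    have hF : ∀ ψ, ‖F ψ‖ ≤ M * ‖e ψ‖ := fun ψ => hbound ψ t ht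
    refine ⟨(InnerProductSpace.toDual ℝ H).symm (F.extendOfNorm e), ?_, fun ψ => ?_⟩
    · rw [LinearIsometryEquiv.norm_map]
      exact ContinuousLinearMap.opNorm_le_bound _ hM
        (LinearMap.norm_extendOfNorm_apply_le he M hF)
    · rw [InnerProductSpace.toDual_symm_apply]
      exact LinearMap.extendOfNorm_eq he ⟨M, hF⟩ ψ
  choose! g hgM hgG using hex
  refine ⟨g, hgM, fun v => ?_, ?_, fun ψ t ht => hgG t ht ψ⟩
  · refine continuousOn_of_uniform_approx_of_continuousOn fun u hu => ?_
    obtain ⟨ε, hε, hεu⟩ := Metric.mem_uniformity_dist.1 hu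
    obtain ⟨ψ, hψ⟩ := he.exists_dist_lt v (ε := ε / (M + 1)) (by positivity)
    refine ⟨G ψ, hGc ψ, fun t ht => hεu ?_⟩
    rw [← hgG t ht, Real.dist_eq, ← inner_sub_right]
    refine (abs_real_inner_le_norm _ _).trans_lt ?_
    rw [dist_eq_norm] at hψ
    calc ‖g t‖ * ‖v - e ψ‖ ≤ M * ‖v - e ψ‖ := by gcongr; exact hgM t ht
      _ ≤ (M + 1) * ‖v - e ψ‖ := by gcongr; linarith
      _ < (M + 1) * (ε / (M + 1)) := by gcongr
      _ = ε := by field_simp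
  -- A countable dense set of test vectors leaves a single null set of times.
  · obtain ⟨S, hSr, hSc, hSd⟩ := Dense.exists_countable_dense_subset he
    have hS : ∀ᵐ t ∂volume.restrict (Icc 0 T), ∀ v ∈ S, ⟪U t, v⟫ = ⟪g t, v⟫ := by
      rw [ae_ball_iff hSc]
      intro v hv
      obtain ⟨ψ, rfl⟩ := hSr hv
      filter_upwards [hG ψ, ae_restrict_mem measurableSet_Icc] with t h1 h2
      rw [h1, hgG t h2]
    filter_upwards [hS] with t ht
    have : (fun v => ⟪U t, v⟫) = fun v => ⟪g t, v⟫ :=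
      Continuous.ext_on hSd (by fun_prop) (by fun_prop) fun v hv => ht v hv
    exact (ext_inner_right ℝ fun v => congrFun this v).symm

end WeakVersion

/-! ### The flux as a bounded operator on L² -/

section Kernel

variable {d n : ℕ}

theorem measurePreserving_snoc : MeasurePreserving
    (fun p : Conf d n × Rd d => (Fin.snoc p.1 p.2 : Conf d (n + 1)))
    ((volume : Measure (Conf d n)).prod volume) volume := by
  have h := (volume_preserving_piFinSuccAbove (fun _ : Fin (n + 1) => Rd d) (Fin.last n)).symm
  have h2 := h.comp (Measure.measurePreserving_swap (μ := (volume : Measure (Conf d n)))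
    (ν := (volume : Measure (Rd d))))
  have he : (fun p : Conf d n × Rd d => (Fin.snoc p.1 p.2 : Conf d (n + 1)))
      = (MeasurableEquiv.piFinSuccAbove (fun _ : Fin (n + 1) => Rd d) (Fin.last n)).symm
        ∘ Prod.swap :=
    funext fun p => (Fin.insertNth_last' (β := Rd d) p.2 p.1).symm
  rw [he]
  exact h2

theorem lintegral_enorm_sq_eq {α E : Type*} [MeasurableSpace α] [NormedAddCommGroup E]
    (m : Measure α) (f : α → E) : ∫⁻ x, ‖f x‖ₑ ^ (2 : ℝ) ∂m = eLpNorm f 2 m ^ (2 : ℝ) := by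
  have := eLpNorm_nnreal_pow_eq_lintegral (μ := m) (f := f) (p := 2) (by norm_num)
  simpa using this.symm

/-- The integral `∫ κ(x_i - z) u(x, z) dz`. -/
noncomputable def kernelIntegral (κ : Rd d → ℝ) (i : Fin n) (u : Conf d (n + 1) → ℝ)
    (x : Conf d n) : ℝ :=
  ∫ z, u (Fin.snoc x z) * κ (x i - z)

theorem ae_memLp_snoc {u : Conf d (n + 1) → ℝ} (hu : MemLp u 2 volume) :
    ∀ᵐ x : Conf d n, MemLp (fun z : Rd d => u (Fin.snoc x z)) 2 volume := by
  have h := hu.comp_measurePreserving (measurePreserving_snoc (d := d) (n := n))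
  have hm := h.1.prodMk_left
  have hi := ((memLp_two_iff_integrable_sq h.1).1 h).prod_right_ae
  filter_upwards [hm, hi] with x h1 h2
  exact (memLp_two_iff_integrable_sq h1).2 h2

theorem memLp_comp_sub_left {E : Type*} [NormedAddCommGroup E] {κ : Rd d → E}
    (hκ : MemLp κ 2 volume) (y : Rd d) : MemLp (fun z => κ (y - z)) 2 volume :=
  hκ.comp_measurePreserving (Measure.measurePreserving_sub_left volume y)

theorem aestronglyMeasurable_kernelIntegral {κ : Rd d → ℝ} (hκ : MemLp κ 2 volume) (i : Fin n)
    {u : Conf d (n + 1) → ℝ} (hu : AEStronglyMeasurable u volume) :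
    AEStronglyMeasurable (kernelIntegral κ i u) volume := by
  -- For each fixed x a null modification of κ does not affect the integral in z, so κ may be taken
  -- strongly measurable, which makes κ(x_i - z) jointly measurable.
  obtain ⟨κ', hκ'm, hκ'⟩ := hκ.1
  have h1 : kernelIntegral κ i u = kernelIntegral κ' i u := by
    funext x
    refine integral_congr_ae ?_
    have := (Measure.measurePreserving_sub_left volume (x i)).quasiMeasurePreserving.ae_eq_comp hκ'
    filter_upwards [this] with z hz
    simp only [Function.comp_apply] at hz
    rw [hz]
  rw [h1]
  refine AEStronglyMeasurable.integral_prod_right'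
    (f := fun p : Conf d n × Rd d => u (Fin.snoc p.1 p.2) * κ' (p.1 i - p.2)) ?_
  refine (hu.comp_measurePreserving measurePreserving_snoc).mul ?_
  exact (hκ'm.comp_measurable (by fun_prop)).aestronglyMeasurable

/-- Cauchy–Schwarz in z for fixed x: the kernel factor is independent of x by translation
invariance, and integrating the square in x leaves the norm of u. -/
theorem eLpNorm_kernelIntegral_le {κ : Rd d → ℝ} (hκ : MemLp κ 2 volume) (i : Fin n)
    {u : Conf d (n + 1) → ℝ} (hu : AEStronglyMeasurable u volume) :
    eLpNorm (kernelIntegral κ i u) 2 volume ≤ eLpNorm κ 2 volume * eLpNorm u 2 volume := by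
  have hsnoc := hu.comp_measurePreserving (measurePreserving_snoc (d := d) (n := n))
  rw [← ENNReal.rpow_le_rpow_iff (z := 2) (by norm_num),
    ENNReal.mul_rpow_of_nonneg _ _ (by norm_num), ← lintegral_enorm_sq_eq]
  have hpt : ∀ᵐ x : Conf d n, ‖kernelIntegral κ i u x‖ₑ ^ (2 : ℝ)
      ≤ eLpNorm κ 2 volume ^ (2 : ℝ) * ∫⁻ z : Rd d, ‖u (Fin.snoc x z)‖ₑ ^ (2 : ℝ) := by
    filter_upwards [hsnoc.prodMk_left] with x hx
    have hκx := memLp_comp_sub_left hκ (x i)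
    have hnorm : eLpNorm (fun z => κ (x i - z)) 2 volume = eLpNorm κ 2 volume :=
      eLpNorm_comp_measurePreserving hκ.1 (Measure.measurePreserving_sub_left volume (x i))
    have h1 : ‖kernelIntegral κ i u x‖ₑ ≤
        (∫⁻ z : Rd d, ‖u (Fin.snoc x z)‖ₑ ^ (2 : ℝ)) ^ (1 / (2 : ℝ))
          * (∫⁻ z, ‖κ (x i - z)‖ₑ ^ (2 : ℝ)) ^ (1 / (2 : ℝ)) := by
      refine (enorm_integral_le_lintegral_enorm _).trans ?_
      simp only [enorm_mul]
      exact ENNReal.lintegral_mul_le_Lp_mul_Lq volume Real.HolderConjugate.two_two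
        hx.enorm hκx.1.enorm
    refine (ENNReal.rpow_le_rpow h1 (by norm_num)).trans_eq ?_
    rw [ENNReal.mul_rpow_of_nonneg _ _ (by norm_num), ← ENNReal.rpow_mul, ← ENNReal.rpow_mul,
      lintegral_enorm_sq_eq volume fun z => κ (x i - z), hnorm, mul_comm]
    norm_num
  refine (lintegral_mono_ae hpt).trans_eq ?_
  rw [lintegral_const_mul' _ _ (ENNReal.rpow_ne_top_of_nonneg (by norm_num) hκ.2.ne),
    ← eLpNorm_comp_measurePreserving hu measurePreserving_snoc,
    ← lintegral_enorm_sq_eq (volume.prod volume),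
    lintegral_prod _ (hsnoc.enorm.pow_const 2)]
  rfl

theorem ae_integrable_kernel {E : Type*} [NormedAddCommGroup E] [NormedSpace ℝ E] {κ : Rd d → E}
    (hκ : MemLp κ 2 volume) (i : Fin n) {u : Conf d (n + 1) → ℝ} (hu : MemLp u 2 volume) :
    ∀ᵐ x : Conf d n, Integrable (fun z => u (Fin.snoc x z) • κ (x i - z)) volume := by
  filter_upwards [ae_memLp_snoc hu] with x hx
  exact memLp_one_iff_integrable.1 ((memLp_comp_sub_left hκ (x i)).smul hx)

theorem kernelIntegral_congr_ae (κ : Rd d → ℝ) (i : Fin n) {u v : Conf d (n + 1) → ℝ}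
    (h : u =ᵐ[volume] v) : kernelIntegral κ i u =ᵐ[volume] kernelIntegral κ i v := by
  have := Measure.ae_ae_of_ae_prod
    ((measurePreserving_snoc (d := d) (n := n)).quasiMeasurePreserving.ae_eq_comp h)
  filter_upwards [this] with x hx
  refine integral_congr_ae ?_
  filter_upwards [hx] with z hz
  simp only [Function.comp_apply] at hz
  rw [hz]

theorem memLp_kernelIntegral {κ : Rd d → ℝ} (hκ : MemLp κ 2 volume) (i : Fin n)
    {u : Conf d (n + 1) → ℝ} (hu : MemLp u 2 volume) : MemLp (kernelIntegral κ i u) 2 volume :=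
  ⟨aestronglyMeasurable_kernelIntegral hκ i hu.1,
    (eLpNorm_kernelIntegral_le hκ i hu.1).trans_lt (ENNReal.mul_lt_top hκ.2 hu.2)⟩

/-- The operator `u ↦ ∫ κ(x_i - z) u(x, z) dz` from `L²(ℝ^{d(n+1)})` to `L²(ℝ^{dn})`. -/
noncomputable def kernelOp {κ : Rd d → ℝ} (hκ : MemLp κ 2 volume) (i : Fin n) :
    Lp ℝ 2 (volume : Measure (Conf d (n + 1))) →L[ℝ] Lp ℝ 2 (volume : Measure (Conf d n)) :=
  LinearMap.mkContinuous
    { toFun := fun u => (memLp_kernelIntegral hκ i (Lp.memLp u)).toLp _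
      map_add' := fun u v => by
        rw [← MemLp.toLp_add, MemLp.toLp_eq_toLp_iff]
        refine (kernelIntegral_congr_ae κ i (Lp.coeFn_add u v)).trans ?_
        filter_upwards [ae_integrable_kernel hκ i (Lp.memLp u),
          ae_integrable_kernel hκ i (Lp.memLp v)] with x hu hv
        simp only [kernelIntegral, Pi.add_apply, add_mul]
        exact integral_add hu hv
      map_smul' := fun c u => by
        rw [RingHom.id_apply, ← MemLp.toLp_const_smul, MemLp.toLp_eq_toLp_iff]
        refine (kernelIntegral_congr_ae κ i (Lp.coeFn_smul c u)).trans (.of_forall fun x => ?_)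
        simp only [kernelIntegral, Pi.smul_apply, smul_eq_mul, mul_assoc]
        exact integral_const_mul _ _ }
    (eLpNorm κ 2 volume).toReal fun u => by
      simp only [LinearMap.coe_mk, AddHom.coe_mk, Lp.norm_toLp]
      rw [Lp.norm_def, ← ENNReal.toReal_mul]
      exact ENNReal.toReal_mono (ENNReal.mul_ne_top hκ.2.ne (Lp.memLp u).2.ne)
        (eLpNorm_kernelIntegral_le hκ i (Lp.memLp u).1)

theorem norm_kernelOp_le {κ : Rd d → ℝ} (hκ : MemLp κ 2 volume) (i : Fin n)
    (u : Lp ℝ 2 (volume : Measure (Conf d (n + 1)))) :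
    ‖kernelOp hκ i u‖ ≤ (eLpNorm κ 2 volume).toReal * ‖u‖ :=
  (ContinuousLinearMap.le_opNorm _ _).trans (mul_le_mul_of_nonneg_right
    (LinearMap.mkContinuous_norm_le _ ENNReal.toReal_nonneg _) (norm_nonneg _))

theorem coeFn_kernelOp_toLp {κ : Rd d → ℝ} (hκ : MemLp κ 2 volume) (i : Fin n)
    {u : Conf d (n + 1) → ℝ} (hu : MemLp u 2 volume) :
    (kernelOp hκ i (hu.toLp u) : Conf d n → ℝ) =ᵐ[volume] kernelIntegral κ i u :=
  (memLp_kernelIntegral hκ i (Lp.memLp _)).coeFn_toLp.trans (kernelIntegral_congr_ae κ i hu.coeFn_toLp)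

theorem hierFlux_apply_ae {K : Rd d → Rd d} (hK : MemLp K 2 volume) {h : TreeFlow d}
    (T : LabeledTree n) (i : Fin n) (t : ℝ) (hu : MemLp (h (n + 1) (T.addLeaf i) t) 2 volume) :
    ∀ᵐ x, ∀ k, hierFlux K h T i t x k
      = kernelIntegral (fun z => K z k) i (h (n + 1) (T.addLeaf i) t) x := by
  filter_upwards [ae_integrable_kernel hK i hu] with x hx k
  exact ((EuclideanSpace.proj (𝕜 := ℝ) k).integral_comp_comm hx).symm

/-- Estimating the flux coordinate by coordinate therefore costs no dimensional constant. -/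
theorem sum_eLpNorm_sq_eq {K : Rd d → Rd d} (hK : MemLp K 2 volume) :
    ∑ k, (eLpNorm (fun z => K z k) 2 volume).toReal ^ 2 = (eLpNorm K 2 volume).toReal ^ 2 := by
  have hreal : ∀ a : ℝ≥0∞, a.toReal ^ 2 = (a ^ (2 : ℝ)).toReal := fun a => by
    rw [← ENNReal.toReal_rpow, Real.rpow_two]
  simp only [hreal, ← lintegral_enorm_sq_eq]
  have hfin : ∀ k, ∫⁻ z, ‖K z k‖ₑ ^ (2 : ℝ) ≠ ⊤ := fun k => by
    rw [lintegral_enorm_sq_eq]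
    exact ENNReal.rpow_ne_top_of_nonneg (by norm_num) (hK.eval_piLp k).2.ne
  rw [← ENNReal.toReal_sum fun k _ => hfin k,
    ← lintegral_finsetSum' _ fun k _ => (hK.eval_piLp k).1.enorm.pow_const 2]
  congr 1
  refine lintegral_congr fun z => ?_
  simp only [← ofReal_norm, ENNReal.rpow_two, ← ENNReal.ofReal_pow (norm_nonneg _)]
  rw [EuclideanSpace.norm_sq_eq, ENNReal.ofReal_sum_of_nonneg fun _ _ => by positivity]

end Kernel

/-! ### From the weak hierarchy to the scalar inequalities -/

section Hierarchy

open testSpace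

variable {d : ℕ}

/-- The coordinate directions of `ℝ^{dn}`. -/
noncomputable def coordVec (d n : ℕ) (j : Fin n × Fin d) : Conf d n :=
  Pi.single j.1 (EuclideanSpace.single j.2 1)

/-- The space `L²(ℝ^{dn})`. -/
abbrev ConfL2 (d n : ℕ) : Type := Lp ℝ 2 (volume : Measure (Conf d n))

/-- The weak form of the hierarchy for weakly continuous curves in `L²`. -/
structure IsWeakHierarchy (tstar ν lam C : ℝ) {K : Rd d → Rd d} (hK : MemLp K 2 volume)
    (G : ∀ n, LabeledTree n → ℝ → ConfL2 d n) : Prop where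
  norm_le : ∀ (n : ℕ) T, ∀ t ∈ Icc 0 tstar, lam ^ ((n : ℝ) / 2) * ‖G n T t‖ ≤ C
  weak_cont : ∀ n T v, ContinuousOn (fun t => ⟪G n T t, v⟫) (Icc 0 tstar)
  evolution : ∀ n (T : LabeledTree n) (ψ : testSpace (Conf d n)) s t, 0 ≤ s → s ≤ t → t ≤ tstar →
    ⟪G n T t - G n T s, toL2 volume ψ⟫ = ∫ r in s..t, ∑ j : Fin n × Fin d,
      (ν * ⟪G n T r, toL2 volume (dirDeriv (coordVec d n j) (dirDeriv (coordVec d n j) ψ))⟫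
        + ⟪kernelOp (hK.eval_piLp j.2) j.1 (G (n + 1) (T.addLeaf j.1) r),
            toL2 volume (dirDeriv (coordVec d n j) ψ)⟫)

namespace IsWeakHierarchy

variable {tstar ν lam C : ℝ} {K : Rd d → Rd d} {hK : MemLp K 2 volume}
  {G : ∀ n, LabeledTree n → ℝ → ConfL2 d n}

theorem norm_le' (h : IsWeakHierarchy tstar ν lam C hK G) (hlam : 0 < lam) (n : ℕ)
    (T : LabeledTree n) {t : ℝ} (ht : t ∈ Icc 0 tstar) :
    ‖G n T t‖ ≤ C / lam ^ ((n : ℝ) / 2) := by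
  rw [le_div_iff₀ (Real.rpow_pos_of_pos hlam _), mul_comm]
  exact h.norm_le n T t ht

theorem pow_mul_norm_sq_le (h : IsWeakHierarchy tstar ν lam C hK G) (hlam : 0 < lam) (n : ℕ)
    (T : LabeledTree n) {t : ℝ} (ht : t ∈ Icc 0 tstar) :
    lam ^ n * ‖G n T t‖ ^ 2 ≤ C ^ 2 := by
  have h1 := pow_le_pow_left₀ (by positivity) (h.norm_le n T t ht) 2
  have h2 : (lam ^ ((n : ℝ) / 2)) ^ 2 = lam ^ n := by
    rw [← Real.rpow_natCast, ← Real.rpow_mul hlam.le, ← Real.rpow_natCast]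
    congr 1
    push_cast
    ring
  rwa [mul_pow, h2] at h1

/-- Bounded operators preserve weak continuity: pass to the adjoint. -/
theorem weak_cont_flux (h : IsWeakHierarchy tstar ν lam C hK G) (n : ℕ) (T : LabeledTree n)
    (j : Fin n × Fin d) (v : ConfL2 d n) : ContinuousOn (fun t =>
      ⟪kernelOp (hK.eval_piLp j.2) j.1 (G (n + 1) (T.addLeaf j.1) t), v⟫) (Icc 0 tstar) := by
  simp only [← ContinuousLinearMap.adjoint_inner_right]
  exact h.weak_cont _ _ _

theorem isWeakEvolution (h : IsWeakHierarchy tstar ν lam C hK G) (hlam : 0 < lam) (n : ℕ)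
    (T : LabeledTree n) : ∃ M, IsWeakEvolution (coordVec d n) tstar ν M (G n T)
      (fun j t => kernelOp (hK.eval_piLp j.2) j.1 (G (n + 1) (T.addLeaf j.1) t)) := by
  set M₁ := C / lam ^ ((n : ℝ) / 2) with hM₁
  set M₂ := C / lam ^ (((n + 1 : ℕ) : ℝ) / 2) with hM₂
  set N : ℝ := ∑ j : Fin n × Fin d, ‖kernelOp (hK.eval_piLp j.2) j.1‖ with hN
  refine ⟨max M₁ (N * M₂), fun t ht => (h.norm_le' hlam n T ht).trans (le_max_left _ _),
    fun j t ht => le_trans ?_ (le_max_right _ _), h.weak_cont n T, h.weak_cont_flux n T,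
    h.evolution n T⟩
  have h1 := h.norm_le' hlam (n + 1) (T.addLeaf j.1) ht
  refine (ContinuousLinearMap.le_opNorm_of_le _ h1).trans
    (mul_le_mul_of_nonneg_right ?_ ((norm_nonneg _).trans h1))
  exact Finset.single_le_sum (f := fun j : Fin n × Fin d => ‖kernelOp (hK.eval_piLp j.2) j.1‖)
    (fun _ _ => norm_nonneg _) (Finset.mem_univ j)

/-- In the energy inequality the sum over coordinates gives ‖K‖² and the sum over vertices gives n.
Passing from the weight of order n + 1 to that of order n leaves 1/(θλ), the remaining factor of σ.
-/
theorem treeInequality (h : IsWeakHierarchy tstar ν lam C hK G) (hν : 0 < ν) (hlam : 0 < lam)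
    (hC : 0 < C) {θ : ℝ} (hθ : 0 < θ) :
    TreeInequality tstar ((eLpNorm K 2 volume).toReal ^ 2 / (2 * θ * lam * ν)) θ
      (fun n T t => (θ * lam) ^ n * ‖G n T t‖ ^ 2 / C ^ 2) := by
  refine ⟨fun n T t ht => ?_, fun n T s t hs hst ht k hk hx => ?_⟩
  · rw [div_le_iff₀ (by positivity), mul_pow, mul_assoc]
    exact mul_le_mul_of_nonneg_left (h.pow_mul_norm_sq_le hlam n T ht) (by positivity)
  · obtain ⟨M, hM⟩ := h.isWeakEvolution hlam n T
    set κ := (eLpNorm K 2 volume).toReal with hκ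
    have hq : 0 < (θ * lam) ^ (n + 1) := by positivity
    have hE := hM.energy_le hν hs hst ht
      (k := fun r => (κ ^ 2 * n * (C ^ 2 / (θ * lam) ^ (n + 1))) * k r) (by fun_prop)
      (fun r hr => by
        have h1 : ∀ j : Fin n × Fin d,
            ‖kernelOp (hK.eval_piLp j.2) j.1 (G (n + 1) (T.addLeaf j.1) r)‖ ^ 2
            ≤ (eLpNorm (fun z => K z j.2) 2 volume).toReal ^ 2
              * ((C ^ 2 / (θ * lam) ^ (n + 1)) * k r) := by
          intro j
          have e1 := pow_le_pow_left₀ (norm_nonneg _) (norm_kernelOp_le (hK.eval_piLp j.2) j.1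
            (G (n + 1) (T.addLeaf j.1) r)) 2
          rw [mul_pow] at e1
          refine e1.trans (mul_le_mul_of_nonneg_left ?_ (by positivity))
          have e2 := hx j.1 r hr
          rw [div_le_iff₀ (by positivity)] at e2
          rw [div_mul_eq_mul_div, le_div_iff₀ hq]
          linarith
        refine (Finset.sum_le_sum fun j _ => h1 j).trans_eq ?_
        rw [Fintype.sum_prod_type]
        simp only [← Finset.sum_mul, sum_eLpNorm_sq_eq hK]
        rw [Finset.sum_const, Finset.card_univ, Fintype.card_fin, nsmul_eq_mul]
        ring)
    rw [intervalIntegral.integral_const_mul] at hE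
    have hE2 := mul_le_mul_of_nonneg_left hE
      (show 0 ≤ (θ * lam) ^ n / C ^ 2 by positivity)
    calc (θ * lam) ^ n * ‖G n T t‖ ^ 2 / C ^ 2
        = (θ * lam) ^ n / C ^ 2 * ‖G n T t‖ ^ 2 := by ring
      _ ≤ _ := hE2
      _ = _ := by
        rw [pow_succ (θ * lam) n]
        field_simp

end IsWeakHierarchy

end Hierarchy

/-! ### Product test functions η(t)ψ(x) -/

section ProductTest

open testSpace

variable {d n : ℕ}

theorem isTestFunction_mul {tstar : ℝ} {η : ℝ → ℝ} (hη : ContDiff ℝ ∞ η)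
    (hηc : HasCompactSupport η) (hηs : tsupport η ⊆ Iio tstar) (ψ : testSpace (Conf d n)) :
    IsTestFunction tstar (fun p : ℝ × Conf d n => η p.1 * ψ.1 p.2) where
  smooth := (hη.comp contDiff_fst).mul (ψ.2.1.comp contDiff_snd)
  compact := by
    refine HasCompactSupport.intro (hηc.isCompact.prod ψ.2.2.isCompact) fun p hp => ?_
    rw [mem_prod, not_and_or] at hp
    rcases hp with hp | hp
    · simp [image_eq_zero_of_notMem_tsupport hp]
    · simp [image_eq_zero_of_notMem_tsupport hp]
  support := by
    refine Subset.trans (closure_minimal (t := tsupport η ×ˢ univ) ?_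
      ((isClosed_tsupport η).prod isClosed_univ)) (prod_mono hηs Subset.rfl)
    intro p hp
    exact ⟨subset_tsupport η (left_ne_zero_of_mul hp), mem_univ _⟩

theorem hasFDerivAt_mul_prod {η : ℝ → ℝ} (hη : ContDiff ℝ ∞ η) (ψ : testSpace (Conf d n)) (t : ℝ)
    (x : Conf d n) : HasFDerivAt (fun p : ℝ × Conf d n => η p.1 * ψ.1 p.2)
      (η t • (fderiv ℝ ψ.1 x).comp (ContinuousLinearMap.snd ℝ ℝ (Conf d n))
        + ψ.1 x • (fderiv ℝ η t).comp (ContinuousLinearMap.fst ℝ ℝ (Conf d n))) (t, x) := by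
  have h1 : HasFDerivAt η (fderiv ℝ η t) t := (hη.differentiable (by simp) t).hasFDerivAt
  have h2 : HasFDerivAt ψ.1 (fderiv ℝ ψ.1 x) x :=
    (ψ.2.1.differentiable (by simp) x).hasFDerivAt
  have h1' : HasFDerivAt (fun p : ℝ × Conf d n => η p.1) _ (t, x) :=
    h1.comp (t, x) hasFDerivAt_fst
  have h2' : HasFDerivAt (fun p : ℝ × Conf d n => ψ.1 p.2) _ (t, x) :=
    h2.comp (t, x) hasFDerivAt_snd
  exact h1'.mul h2'

theorem timeDeriv_mul {η : ℝ → ℝ} (hη : ContDiff ℝ ∞ η) (ψ : testSpace (Conf d n)) (t : ℝ)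
    (x : Conf d n) :
    timeDeriv (fun p : ℝ × Conf d n => η p.1 * ψ.1 p.2) t x = deriv η t * ψ.1 x := by
  rw [timeDeriv, (hasFDerivAt_mul_prod hη ψ t x).fderiv]
  simp [mul_comm]

theorem single_eq_sum_coordVec (i : Fin n) (v : Rd d) :
    (Pi.single i v : Conf d n) = ∑ k, v k • coordVec d n (i, k) := by
  have h : v = ∑ k, v k • EuclideanSpace.single k (1 : ℝ) := by
    simpa using ((EuclideanSpace.basisFun (Fin d) ℝ).sum_repr v).symm
  have h2 := congrArg (ContinuousLinearMap.single ℝ (fun _ : Fin n => Rd d) i) h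
  rw [map_sum] at h2
  simpa [coordVec, Pi.single_smul] using h2

theorem partialGrad_mul {η : ℝ → ℝ} (hη : ContDiff ℝ ∞ η) (ψ : testSpace (Conf d n)) (t : ℝ)
    (x : Conf d n) (i : Fin n) (v : Rd d) :
    partialGrad (fun p : ℝ × Conf d n => η p.1 * ψ.1 p.2) t x i v
      = η t * ∑ k, v k * (dirDeriv (coordVec d n (i, k)) ψ).1 x := by
  rw [partialGrad, (hasFDerivAt_mul_prod hη ψ t x).fderiv, single_eq_sum_coordVec]
  simp [dirDeriv, map_sum]

theorem hasFDerivAt_comp_update (ψ : testSpace (Conf d n)) (x : Conf d n) (i : Fin n) (y : Rd d) :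
    HasFDerivAt (fun y => ψ.1 (Function.update x i y))
      ((fderiv ℝ ψ.1 (Function.update x i y)).comp
        (ContinuousLinearMap.single ℝ (fun _ : Fin n => Rd d) i)) y := by
  have h2 : HasFDerivAt ψ.1 (fderiv ℝ ψ.1 (Function.update x i y)) (Function.update x i y) :=
    (ψ.2.1.differentiable (by simp) _).hasFDerivAt
  refine (h2.comp y (hasFDerivAt_update (𝕜 := ℝ) x y)).congr_fderiv ?_
  congr 1
  ext v j
  rcases eq_or_ne j i with rfl | hij
  · simp
  · simp [hij]

theorem partialLaplacian_mul {η : ℝ → ℝ} (ψ : testSpace (Conf d n)) (t : ℝ) (x : Conf d n)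
    (i : Fin n) : partialLaplacian (fun p : ℝ × Conf d n => η p.1 * ψ.1 p.2) t x i
      = η t * ∑ k, (dirDeriv (coordVec d n (i, k)) (dirDeriv (coordVec d n (i, k)) ψ)).1 x := by
  have hf : fderiv ℝ (fun y : Rd d => η t * ψ.1 (Function.update x i y)) = fun y =>
      η t • ((fderiv ℝ ψ.1 (Function.update x i y)).comp
        (ContinuousLinearMap.single ℝ (fun _ : Fin n => Rd d) i)) :=
    funext fun y => ((hasFDerivAt_comp_update ψ x i y).const_mul (η t)).fderiv
  have hd : DifferentiableAt ℝ (fderiv ℝ (fun y : Rd d => η t * ψ.1 (Function.update x i y)))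
      (x i) := by
    rw [hf]
    have h1 : Differentiable ℝ (fderiv ℝ ψ.1) :=
      ContDiff.differentiable (n := ∞) (ψ.2.1.fderiv_right (m := ∞) (by simp)) (by simp)
    have h2 : DifferentiableAt ℝ (fun y : Rd d => fderiv ℝ ψ.1 (Function.update x i y)) (x i) :=
      (h1 _).comp (x i) (hasFDerivAt_update (𝕜 := ℝ) x (x i)).differentiableAt
    exact (h2.clm_comp (differentiableAt_const _)).const_smul (η t)
  rw [partialLaplacian, InnerProductSpace.laplacian_eq_iteratedFDeriv_orthonormalBasis _
    (EuclideanSpace.basisFun (Fin d) ℝ), Finset.mul_sum]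
  refine Finset.sum_congr rfl fun k _ => ?_
  rw [iteratedFDeriv_two_apply]
  simp only [Matrix.cons_val_zero, Matrix.cons_val_one, EuclideanSpace.basisFun_apply]
  set v : Rd d := EuclideanSpace.single k 1 with hv
  have h3 : HasFDerivAt (fun y => fderiv ℝ (fun y : Rd d => η t * ψ.1 (Function.update x i y)) y v)
      _ (x i) := hd.hasFDerivAt.clm_apply (hasFDerivAt_const v (x i))
  have h4 : (fun y => fderiv ℝ (fun y : Rd d => η t * ψ.1 (Function.update x i y)) y v)
      = fun y => η t * (dirDeriv (coordVec d n (i, k)) ψ).1 (Function.update x i y) := by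
    rw [hf]
    rfl
  rw [h4] at h3
  have h5 := congrArg (fun L => L v) (h3.unique
    ((hasFDerivAt_comp_update (dirDeriv (coordVec d n (i, k)) ψ) x i (x i)).const_mul (η t)))
  simp only [Function.update_eq_self] at h5
  change _ = η t * fderiv ℝ (dirDeriv (coordVec d n (i, k)) ψ).1 x (Pi.single i v)
  simpa using h5

end ProductTest

/-! ### The weakly continuous solution -/

section Existence

open testSpace

variable {d : ℕ}

open Classical in
/-- The class in `L²` of a slice of a flow, when that slice is square integrable. -/
noncomputable def sliceL2 (h : TreeFlow d) (n : ℕ) (T : LabeledTree n) (t : ℝ) : ConfL2 d n :=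
  if hm : MemLp (h n T t) 2 volume then hm.toLp _ else 0

theorem sliceL2_of_memLp {h : TreeFlow d} {n : ℕ} {T : LabeledTree n} {t : ℝ}
    (hm : MemLp (h n T t) 2 volume) : sliceL2 h n T t = hm.toLp _ := dif_pos hm

theorem coeFn_sliceL2 {h : TreeFlow d} {n : ℕ} {T : LabeledTree n} {t : ℝ}
    (hm : MemLp (h n T t) 2 volume) : (sliceL2 h n T t : Conf d n → ℝ) =ᵐ[volume] h n T t := by
  rw [sliceL2_of_memLp hm]
  exact hm.coeFn_toLp

variable {tstar ν lam : ℝ} {K : Rd d → Rd d} {h : TreeFlow d} {h0 : TreeFamily d}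

theorem ae_memLp_slice (hlam : 0 < lam)
    (hmeas : ∀ n (T : LabeledTree n), AEStronglyMeasurable (Function.uncurry (h n T))
      ((timeMeasure tstar).prod volume))
    (hfin : supHierNorm tstar lam h < ⊤) (n : ℕ) (T : LabeledTree n) :
    ∀ᵐ t ∂timeMeasure tstar, MemLp (h n T t) 2 volume ∧
      lam ^ ((n : ℝ) / 2) * ‖sliceL2 h n T t‖ ≤ (supHierNorm tstar lam h).toReal := by
  filter_upwards [(hmeas n T).prodMk_left,
    ENNReal.ae_le_essSup (μ := timeMeasure tstar) fun t => hierNorm lam (h.slice t)] with t h1 h2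
  have hl : 0 < lam ^ ((n : ℝ) / 2) := Real.rpow_pos_of_pos hlam _
  have h3 : ENNReal.ofReal (lam ^ ((n : ℝ) / 2)) * eLpNorm (h n T t) 2 volume
      ≤ supHierNorm tstar lam h :=
    (le_iSup₂ (f := fun (n : ℕ) (T : LabeledTree n) => ENNReal.ofReal (lam ^ ((n : ℝ) / 2))
      * eLpNorm (h.slice t n T) 2 volume) n T).trans h2
  have hm : MemLp (h n T t) 2 volume := by
    refine ⟨h1, ?_⟩
    by_contra hcon
    rw [not_lt_top_iff] at hcon
    rw [hcon, ENNReal.mul_top (by simpa using hl)] at h3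
    exact absurd (top_le_iff.1 h3) hfin.ne
  refine ⟨hm, ?_⟩
  rw [sliceL2_of_memLp hm, Lp.norm_toLp, ← ENNReal.toReal_ofReal hl.le, ← ENNReal.toReal_mul]
  exact ENNReal.toReal_mono hfin.ne h3

theorem aestronglyMeasurable_inner_sliceL2 {n : ℕ} {T : LabeledTree n}
    (hmeas : AEStronglyMeasurable (Function.uncurry (h n T)) ((timeMeasure tstar).prod volume))
    (hm : ∀ᵐ t ∂timeMeasure tstar, MemLp (h n T t) 2 volume) (v : ConfL2 d n) :
    AEStronglyMeasurable (fun t => ⟪sliceL2 h n T t, v⟫) (timeMeasure tstar) := by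
  have h1 : AEStronglyMeasurable (fun t => ∫ x, h n T t x * v x) (timeMeasure tstar) :=
    AEStronglyMeasurable.integral_prod_right'
      (f := fun p : ℝ × Conf d n => Function.uncurry (h n T) p * v p.2)
      (hmeas.mul (Lp.aestronglyMeasurable v).comp_snd)
  refine h1.congr ?_
  filter_upwards [hm] with t ht
  rw [L2_real_inner_eq_integral]
  refine integral_congr_ae ?_
  filter_upwards [coeFn_sliceL2 ht] with x hx
  rw [hx]

theorem memLp_initial_inner {n : ℕ} {T : LabeledTree n} (h0m : MemLp (h0 n T) 2 volume)
    (ψ : testSpace (Conf d n)) : ⟪h0m.toLp _, toL2 volume ψ⟫ = ∫ x, h0 n T x * ψ.1 x := by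
  rw [inner_toL2]
  refine integral_congr_ae ?_
  filter_upwards [h0m.coeFn_toLp] with x hx
  rw [hx]

theorem integrable_mul_test {n : ℕ} (v : ConfL2 d n) (ψ : testSpace (Conf d n)) :
    Integrable (fun x => v x * ψ.1 x) volume :=
  (Lp.memLp v).integrable_mul (testSpace.memLp ψ 2)

/-- The spatial part of the weak formulation for product test functions. -/
theorem integral_weak_eq (hK : MemLp K 2 volume) {n : ℕ} (T : LabeledTree n) {η : ℝ → ℝ}
    (hη : ContDiff ℝ ∞ η) (ψ : testSpace (Conf d n)) {t : ℝ} (hm : MemLp (h n T t) 2 volume)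
    (hm' : ∀ i, MemLp (h (n + 1) (T.addLeaf i) t) 2 volume) :
    ∫ x : Conf d n, (h n T t x * (timeDeriv (fun p : ℝ × Conf d n => η p.1 * ψ.1 p.2) t x
        + ν * ∑ i, partialLaplacian (fun p : ℝ × Conf d n => η p.1 * ψ.1 p.2) t x i)
      + ∑ i, partialGrad (fun p : ℝ × Conf d n => η p.1 * ψ.1 p.2) t x i (hierFlux K h T i t x))
    = ⟪sliceL2 h n T t, toL2 volume ψ⟫ * deriv η t
      + (∑ j : Fin n × Fin d, (ν * ⟪sliceL2 h n T t,
          toL2 volume (dirDeriv (coordVec d n j) (dirDeriv (coordVec d n j) ψ))⟫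
        + ⟪kernelOp (hK.eval_piLp j.2) j.1 (sliceL2 h (n + 1) (T.addLeaf j.1) t),
            toL2 volume (dirDeriv (coordVec d n j) ψ)⟫)) * η t := by
  have hflux : ∀ᵐ x, ∀ j : Fin n × Fin d,
      (kernelOp (hK.eval_piLp j.2) j.1 (sliceL2 h (n + 1) (T.addLeaf j.1) t) : Conf d n → ℝ) x
        = hierFlux K h T j.1 t x j.2 := by
    refine ae_all_iff.2 fun j => ?_
    rw [sliceL2_of_memLp (hm' j.1)]
    filter_upwards [coeFn_kernelOp_toLp (hK.eval_piLp j.2) j.1 (hm' j.1),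
      hierFlux_apply_ae hK T j.1 t (hm' j.1)] with x h1 h2
    rw [h1, h2]
  simp only [inner_toL2]
  have hI1 : Integrable (fun x => (sliceL2 h n T t : Conf d n → ℝ) x * ψ.1 x * deriv η t) volume :=
    (integrable_mul_test _ ψ).mul_const _
  have hI2 : ∀ j : Fin n × Fin d, Integrable (fun x => ν * ((sliceL2 h n T t : Conf d n → ℝ) x
      * (dirDeriv (coordVec d n j) (dirDeriv (coordVec d n j) ψ)).1 x)) volume :=
    fun j => (integrable_mul_test _ _).const_mul _
  have hI3 : ∀ j : Fin n × Fin d, Integrable (fun x =>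
      (kernelOp (hK.eval_piLp j.2) j.1 (sliceL2 h (n + 1) (T.addLeaf j.1) t) : Conf d n → ℝ) x
      * (dirDeriv (coordVec d n j) ψ).1 x) volume := fun j => integrable_mul_test _ _
  have hI4 : Integrable (fun x => (∑ j : Fin n × Fin d, (ν * ((sliceL2 h n T t : Conf d n → ℝ) x
      * (dirDeriv (coordVec d n j) (dirDeriv (coordVec d n j) ψ)).1 x)
      + (kernelOp (hK.eval_piLp j.2) j.1 (sliceL2 h (n + 1) (T.addLeaf j.1) t) : Conf d n → ℝ) x
        * (dirDeriv (coordVec d n j) ψ).1 x)) * η t) volume :=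
    (integrable_finsetSum _ fun j _ => (hI2 j).add (hI3 j)).mul_const _
  have hR : ∑ j : Fin n × Fin d, (ν * (∫ x, (sliceL2 h n T t : Conf d n → ℝ) x
        * (dirDeriv (coordVec d n j) (dirDeriv (coordVec d n j) ψ)).1 x)
      + ∫ x, (kernelOp (hK.eval_piLp j.2) j.1 (sliceL2 h (n + 1) (T.addLeaf j.1) t) :
          Conf d n → ℝ) x * (dirDeriv (coordVec d n j) ψ).1 x)
      = ∫ x, ∑ j : Fin n × Fin d, (ν * ((sliceL2 h n T t : Conf d n → ℝ) x
        * (dirDeriv (coordVec d n j) (dirDeriv (coordVec d n j) ψ)).1 x)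
      + (kernelOp (hK.eval_piLp j.2) j.1 (sliceL2 h (n + 1) (T.addLeaf j.1) t) : Conf d n → ℝ) x
        * (dirDeriv (coordVec d n j) ψ).1 x) := by
    refine Eq.trans ?_ (integral_finsetSum Finset.univ fun j _ => (hI2 j).add (hI3 j)).symm
    refine Finset.sum_congr rfl fun j _ => ?_
    rw [← integral_const_mul]
    exact (integral_add (hI2 j) (hI3 j)).symm
  rw [hR, ← integral_mul_const, ← integral_mul_const, ← integral_add hI1 hI4]
  refine integral_congr_ae ?_
  filter_upwards [hflux, coeFn_sliceL2 hm] with x h1 h2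
  rw [timeDeriv_mul hη]
  simp only [partialGrad_mul hη, partialLaplacian_mul, h1, h2]
  rw [Finset.sum_add_distrib, Fintype.sum_prod_type, Fintype.sum_prod_type]
  simp only [← Finset.mul_sum]
  ring

/-- The right-hand side of the weak hierarchy, as a function of time. -/
noncomputable def weakRate (ν : ℝ) (hK : MemLp K 2 volume)
    (G : ∀ n, LabeledTree n → ℝ → ConfL2 d n) {n : ℕ} (T : LabeledTree n)
    (ψ : testSpace (Conf d n)) (r : ℝ) : ℝ :=
  ∑ j : Fin n × Fin d,
      (ν * ⟪G n T r, toL2 volume (dirDeriv (coordVec d n j) (dirDeriv (coordVec d n j) ψ))⟫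
        + ⟪kernelOp (hK.eval_piLp j.2) j.1 (G (n + 1) (T.addLeaf j.1) r),
            toL2 volume (dirDeriv (coordVec d n j) ψ)⟫)

theorem integrable_inner_sliceL2 (hlam : 0 < lam)
    (hmeas : ∀ n (T : LabeledTree n), AEStronglyMeasurable (Function.uncurry (h n T))
      ((timeMeasure tstar).prod volume))
    (hfin : supHierNorm tstar lam h < ⊤) (n : ℕ) (T : LabeledTree n) (v : ConfL2 d n) :
    Integrable (fun t => ⟪sliceL2 h n T t, v⟫) (timeMeasure tstar) := by
  have hfm : IsFiniteMeasure (timeMeasure tstar) := by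
    unfold timeMeasure; infer_instance
  have hae := ae_memLp_slice hlam hmeas hfin n T
  refine Integrable.of_bound (aestronglyMeasurable_inner_sliceL2 (hmeas n T)
    (hae.mono fun _ ht => ht.1) v)
    ((supHierNorm tstar lam h).toReal / lam ^ ((n : ℝ) / 2) * ‖v‖) ?_
  filter_upwards [hae] with t ht
  refine (norm_inner_le_norm _ _).trans (mul_le_mul_of_nonneg_right ?_ (norm_nonneg _))
  rw [le_div_iff₀ (Real.rpow_pos_of_pos hlam _), mul_comm]
  exact ht.2

theorem integrable_weakRate_sliceL2 (hlam : 0 < lam) (hK : MemLp K 2 volume)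
    (hmeas : ∀ n (T : LabeledTree n), AEStronglyMeasurable (Function.uncurry (h n T))
      ((timeMeasure tstar).prod volume))
    (hfin : supHierNorm tstar lam h < ⊤) {n : ℕ} (T : LabeledTree n)
    (ψ : testSpace (Conf d n)) :
    Integrable (weakRate ν hK (sliceL2 h) T ψ) (timeMeasure tstar) := by
  refine integrable_finsetSum _ fun j _ => Integrable.add ?_ ?_
  · exact (integrable_inner_sliceL2 hlam hmeas hfin n T _).const_mul ν
  · simp only [← ContinuousLinearMap.adjoint_inner_right]
    exact integrable_inner_sliceL2 hlam hmeas hfin _ _ _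

/-- Product test functions reduce the weak formulation, for each fixed ψ, to a scalar equation in
time, to which the du Bois-Reymond lemma applies. -/
theorem ae_inner_sliceL2_eq (ht : 0 < tstar) (hlam : 0 < lam) (hK : MemLp K 2 volume)
    (hsol : IsHierarchySolution tstar ν K h h0) (hfin : supHierNorm tstar lam h < ⊤) {n : ℕ}
    (T : LabeledTree n) (ψ : testSpace (Conf d n)) :
    ∀ᵐ t ∂timeMeasure tstar, ⟪sliceL2 h n T t, toL2 volume ψ⟫
      = ⟪(hsol.initial_memL2 n T).toLp _, toL2 volume ψ⟫
        + ∫ r in (0 : ℝ)..t, weakRate ν hK (sliceL2 h) T ψ r := by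
  have hmeas := fun n (T : LabeledTree n) => (hsol.memL2 n T).1
  refine ae_eq_add_integral_of_forall_test ht
    (integrable_inner_sliceL2 hlam hmeas hfin n T _)
    (integrable_weakRate_sliceL2 hlam hK hmeas hfin T ψ) fun η hη hηc hηs => ?_
  have hw := hsol.weak n T _ (isTestFunction_mul hη hηc hηs ψ)
  rw [memLp_initial_inner, ← integral_mul_const]
  refine Eq.trans (congrArg₂ (· + ·) (integral_congr_ae ?_)
    (integral_congr_ae (.of_forall fun x => ?_))) hw
  · filter_upwards [ae_memLp_slice hlam hmeas hfin n T,
      ae_all_iff.2 fun i => ae_memLp_slice hlam hmeas hfin (n + 1) (T.addLeaf i)] with t h1 h2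
    exact (integral_weak_eq hK T hη ψ h1.1 fun i => (h2 i).1).symm
  · simp only
    ring

theorem secondCountableTopology_L2 {V : Type*} [NormedAddCommGroup V] [NormedSpace ℝ V]
    [MeasurableSpace V] [BorelSpace V] [FiniteDimensional ℝ V] (μ : Measure V)
    [μ.IsAddHaarMeasure] : SecondCountableTopology (Lp ℝ 2 μ) := by
  have : Fact ((2 : ℝ≥0∞) ≠ ⊤) := ⟨by simp⟩
  infer_instance

theorem exists_isWeakHierarchy (ht : 0 < tstar) (hlam : 0 < lam) (hK : MemLp K 2 volume)
    (hsol : IsHierarchySolution tstar ν K h h0) (hfin : supHierNorm tstar lam h < ⊤) :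
    ∃ G : ∀ n, LabeledTree n → ℝ → ConfL2 d n,
      IsWeakHierarchy tstar ν lam (supHierNorm tstar lam h).toReal hK G ∧
      (∀ n (T : LabeledTree n), ∀ᵐ t ∂timeMeasure tstar,
        (G n T t : Conf d n → ℝ) =ᵐ[volume] h n T t) ∧
      ∀ n (T : LabeledTree n), (G n T 0 : Conf d n → ℝ) =ᵐ[volume] h0 n T := by
  have hmeas := fun n (T : LabeledTree n) => (hsol.memL2 n T).1
  have hW : ∀ n (T : LabeledTree n) (ψ : testSpace (Conf d n)),
      IntervalIntegrable (weakRate ν hK (sliceL2 h) T ψ) volume 0 tstar := fun n T ψ =>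
    (intervalIntegrable_iff_integrableOn_Icc_of_le ht.le).2
      (integrable_weakRate_sliceL2 hlam hK hmeas hfin T ψ)
  have hex : ∀ n (T : LabeledTree n), ∃ g : ℝ → ConfL2 d n,
      (∀ t ∈ Icc 0 tstar, ‖g t‖ ≤ (supHierNorm tstar lam h).toReal / lam ^ ((n : ℝ) / 2)) ∧
      (∀ v, ContinuousOn (fun t => ⟪g t, v⟫) (Icc 0 tstar)) ∧
      (∀ᵐ t ∂timeMeasure tstar, g t = sliceL2 h n T t) ∧
      ∀ (ψ : testSpace (Conf d n)), ∀ t ∈ Icc 0 tstar, ⟪g t, toL2 volume ψ⟫ =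
        ⟪(hsol.initial_memL2 n T).toLp _, toL2 volume ψ⟫
          + ∫ r in (0 : ℝ)..t, weakRate ν hK (sliceL2 h) T ψ r := by
    intro n T
    have := secondCountableTopology_L2 (V := Conf d n) volume
    refine exists_weaklyContinuous_version (denseRange_toL2 (V := Conf d n)) ht
      (div_nonneg ENNReal.toReal_nonneg (Real.rpow_nonneg hlam.le _)) ?_ (fun ψ => ?_)
      fun ψ => ae_inner_sliceL2_eq ht hlam hK hsol hfin T ψ
    · filter_upwards [ae_memLp_slice hlam hmeas hfin n T] with t h1
      rw [le_div_iff₀ (Real.rpow_pos_of_pos hlam _), mul_comm]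
      exact h1.2
    · have := intervalIntegral.continuousOn_primitive_interval' (hW n T ψ) left_mem_uIcc
      rw [uIcc_of_le ht.le] at this
      exact continuousOn_const.add this
  choose G hGM hGc hGU hGψ using hex
  refine ⟨G, ⟨fun n T t htm => ?_, hGc, fun n T ψ s t hs hst htt => ?_⟩, fun n T => ?_,
    fun n T => ?_⟩
  · rw [mul_comm, ← le_div_iff₀ (Real.rpow_pos_of_pos hlam _)]
    exact hGM n T t htm
  · have hsub : ∀ a b, 0 ≤ a → a ≤ b → b ≤ tstar →
        IntervalIntegrable (weakRate ν hK (sliceL2 h) T ψ) volume a b := fun a b ha hab hb =>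
      (hW n T ψ).mono_set (by
        rw [uIcc_of_le hab, uIcc_of_le ht.le]; exact Icc_subset_Icc ha hb)
    rw [inner_sub_left, hGψ n T ψ t ⟨hs.trans hst, htt⟩, hGψ n T ψ s ⟨hs, hst.trans htt⟩,
      add_sub_add_left_eq_sub, intervalIntegral.integral_interval_sub_left
        (hsub 0 t le_rfl (hs.trans hst) htt) (hsub 0 s le_rfl hs (hst.trans htt))]
    -- The rate was computed from the slices of h; these agree with G at almost every time, for T
    -- and its finitely many T + i.
    refine intervalIntegral.integral_congr_ae_restrict ?_
    rw [uIoc_of_le hst]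
    have hle : volume.restrict (Ioc s t) ≤ timeMeasure tstar :=
      Measure.restrict_mono (Ioc_subset_Icc_self.trans (Icc_subset_Icc hs htt)) le_rfl
    filter_upwards [ae_mono hle (hGU n T),
      ae_mono hle (ae_all_iff.2 fun i => hGU (n + 1) (T.addLeaf i))] with r h1 h2
    simp only [weakRate, h1, h2]
  · filter_upwards [hGU n T, ae_memLp_slice hlam hmeas hfin n T] with t h1 h2
    rw [h1]
    exact coeFn_sliceL2 h2.1
  · have h1 : G n T 0 = (hsol.initial_memL2 n T).toLp _ := by
      refine (denseRange_toL2 (V := Conf d n)).eq_of_inner_left ℝ fun ψ => ?_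
      rw [hGψ n T ψ 0 ⟨le_rfl, ht.le⟩, intervalIntegral.integral_same, add_zero]
    rw [h1]
    exact MemLp.coeFn_toLp _

end Existence

/-! ### Return to the hierarchy norm; differences of solutions -/

section Conclusion

open testSpace

variable {d : ℕ} {tstar ν lam C : ℝ} {K : Rd d → Rd d} {hK : MemLp K 2 volume}

theorem ofReal_mul_eLpNorm {a : ℝ} (ha : 0 ≤ a) {n : ℕ} (v : ConfL2 d n) :
    ENNReal.ofReal a * eLpNorm v 2 volume = ENNReal.ofReal (a * ‖v‖) := by
  rw [ENNReal.ofReal_mul ha, Lp.norm_def, ENNReal.ofReal_toReal (Lp.memLp v).2.ne]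

theorem rpow_half_mul_norm_sq {a : ℝ} (ha : 0 ≤ a) {n : ℕ} (v : ConfL2 d n) :
    (a ^ ((n : ℝ) / 2) * ‖v‖) ^ 2 = a ^ n * ‖v‖ ^ 2 := by
  rw [mul_pow, ← Real.rpow_natCast (a ^ ((n : ℝ) / 2)), ← Real.rpow_mul ha, ← Real.rpow_natCast a]
  congr 2
  push_cast
  ring

theorem hierNorm_le_iff {a : ℝ} (ha : 0 < a) (u : TreeFamily d)
    (v : ∀ n, LabeledTree n → ConfL2 d n) (huv : ∀ n T, (v n T : Conf d n → ℝ) =ᵐ[volume] u n T)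
    (B : ℝ≥0∞) :
    hierNorm a u ≤ B ↔ ∀ (n : ℕ) T, ENNReal.ofReal (a ^ ((n : ℝ) / 2) * ‖v n T‖) ≤ B := by
  simp only [hierNorm, iSup_le_iff]
  refine forall_congr' fun n => forall_congr' fun T => ?_
  rw [← eLpNorm_congr_ae (huv n T), ofReal_mul_eLpNorm (Real.rpow_nonneg ha.le _)]

/-- Passage from squared and normalised `L²` norms to `hierNorm`. -/
theorem hierNorm_le_of_forall_sq_le {S : ℝ≥0∞} {G : ∀ n, LabeledTree n → ℝ → ConfL2 d n}
    {h0 : TreeFamily d} (hS : S ≠ ⊤) (hlam : 0 < lam) {θ : ℝ} (hθ : 0 < θ) (hθ1 : θ < 1)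
    (hG : IsWeakHierarchy tstar ν lam S.toReal hK G)
    (hG0 : ∀ n (T : LabeledTree n), (G n T 0 : Conf d n → ℝ) =ᵐ[volume] h0 n T)
    {t e A : ℝ} (ht : t ∈ Icc 0 tstar) (he : 0 < e) (hA : 0 ≤ A)
    (hx : 0 < S.toReal → ∀ X, 0 ≤ X →
      (∀ n (T : LabeledTree n), (θ * lam) ^ n * ‖G n T 0‖ ^ 2 / S.toReal ^ 2 ≤ X) →
      ∀ n (T : LabeledTree n), (θ * lam) ^ n * ‖G n T t‖ ^ 2 / S.toReal ^ 2 ≤ A * X ^ e) :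
    hierNorm (θ * lam) (TreeFlow.slice (fun n T t => (G n T t : Conf d n → ℝ)) t)
      ≤ S * (Real.toNNReal (√A) : ℝ≥0∞) * (hierNorm (θ * lam) h0 / S) ^ e := by
  have hθl : 0 < θ * lam := mul_pos hθ hlam
  refine (hierNorm_le_iff hθl _ (fun n T => G n T t)
    (fun n T => Filter.EventuallyEq.rfl) _).2 ?_
  have h0t : (0 : ℝ) ∈ Icc 0 tstar := ⟨le_rfl, ht.1.trans ht.2⟩
  intro n T
  rcases (ENNReal.toReal_nonneg (a := S)).eq_or_lt with hS0 | hS0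
  -- Degenerate case C_λ = 0: the a priori bound forces G to vanish.
  · have h1 := hG.pow_mul_norm_sq_le hlam n T ht
    rw [← hS0, zero_pow two_ne_zero] at h1
    have h2 : ‖G n T t‖ ^ 2 = 0 := by
      have : 0 < lam ^ n := by positivity
      exact le_antisymm (nonpos_of_mul_nonpos_right h1 this) (by positivity)
    rw [pow_eq_zero_iff two_ne_zero] at h2
    simp [h2]
  · have hSpos : S ≠ 0 := fun h => by simp [h] at hS0
    -- The a priori bound at time 0, with θ < 1, makes the ratio of norms finite, so the computation
    -- can be done in ℝ.
    have hle : hierNorm (θ * lam) h0 ≤ S := by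
      rw [hierNorm_le_iff hθl _ (fun n T => G n T 0) hG0]
      intro n T
      rw [← ENNReal.ofReal_toReal hS]
      refine ENNReal.ofReal_le_ofReal ?_
      rw [← pow_le_pow_iff_left₀ (by positivity) hS0.le two_ne_zero, rpow_half_mul_norm_sq hθl.le,
        mul_pow, mul_assoc]
      have h1 := hG.pow_mul_norm_sq_le hlam n T h0t
      have h2 : θ ^ n ≤ 1 := pow_le_one₀ hθ.le hθ1.le
      have h3 : 0 ≤ lam ^ n * ‖G n T 0‖ ^ 2 := by positivity
      nlinarith
    set N := hierNorm (θ * lam) h0 / S with hN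
    have hNtop : N ≠ ⊤ := ENNReal.div_ne_top (ne_top_of_le_ne_top hS hle) hSpos
    have hNS : hierNorm (θ * lam) h0 = ENNReal.ofReal (N.toReal * S.toReal) := by
      rw [ENNReal.ofReal_mul ENNReal.toReal_nonneg, ENNReal.ofReal_toReal hNtop,
        ENNReal.ofReal_toReal hS, hN, ENNReal.div_mul_cancel hSpos hS]
    have h0x : ∀ n (T : LabeledTree n),
        (θ * lam) ^ n * ‖G n T 0‖ ^ 2 / S.toReal ^ 2 ≤ N.toReal ^ 2 := by
      intro n T
      have h1 := (hierNorm_le_iff hθl _ (fun n T => G n T 0) hG0 _).1 hNS.le n T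
      rw [ENNReal.ofReal_le_ofReal_iff (by positivity)] at h1
      rw [div_le_iff₀ (by positivity), ← mul_pow, ← rpow_half_mul_norm_sq hθl.le]
      exact pow_le_pow_left₀ (by positivity) h1 2
    have h1 := hx hS0 _ (by positivity) h0x n T
    have hR : S * (Real.toNNReal (√A) : ℝ≥0∞) * N ^ e
        = ENNReal.ofReal (S.toReal * √A * N.toReal ^ e) := by
      rw [ENNReal.ofReal_mul (by positivity), ENNReal.ofReal_mul (by positivity),
        ENNReal.ofReal_toReal hS, ← ENNReal.ofReal_rpow_of_nonneg ENNReal.toReal_nonneg he.le,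
        ENNReal.ofReal_toReal hNtop]
      rfl
    rw [hR]
    refine ENNReal.ofReal_le_ofReal ?_
    rw [← pow_le_pow_iff_left₀ (by positivity) (by positivity) two_ne_zero,
      rpow_half_mul_norm_sq hθl.le]
    rw [div_le_iff₀ (by positivity)] at h1
    refine h1.trans_eq ?_
    rw [mul_pow, mul_pow, Real.sq_sqrt hA, ← Real.rpow_natCast N.toReal 2,
      ← Real.rpow_mul ENNReal.toReal_nonneg, ← Real.rpow_natCast (N.toReal ^ e) 2,
      ← Real.rpow_mul ENNReal.toReal_nonneg, mul_comm e]
    ring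

namespace IsWeakHierarchy

variable {G G' : ∀ n, LabeledTree n → ℝ → ConfL2 d n}

theorem mono (h : IsWeakHierarchy tstar ν lam C hK G) {lam' C' : ℝ} (hlam' : 0 ≤ lam')
    (hl : lam' ≤ lam) (hC : C ≤ C') : IsWeakHierarchy tstar ν lam' C' hK G where
  norm_le n T t ht := by
    refine le_trans ?_ ((h.norm_le n T t ht).trans hC)
    gcongr
  weak_cont := h.weak_cont
  evolution := h.evolution

theorem continuousOn_weakRate (h : IsWeakHierarchy tstar ν lam C hK G) {n : ℕ}
    (T : LabeledTree n) (ψ : testSpace (Conf d n)) :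
    ContinuousOn (weakRate ν hK G T ψ) (Icc 0 tstar) :=
  continuousOn_finsetSum _ fun j _ =>
    (continuousOn_const.mul (h.weak_cont n T _)).add (h.weak_cont_flux n T j _)

theorem sub {C' : ℝ} (h : IsWeakHierarchy tstar ν lam C hK G)
    (h' : IsWeakHierarchy tstar ν lam C' hK G') (hlam : 0 ≤ lam) :
    IsWeakHierarchy tstar ν lam (C + C') hK (fun n T t => G n T t - G' n T t) where
  norm_le n T t ht := by
    refine (mul_le_mul_of_nonneg_left (norm_sub_le _ _) (by positivity)).trans ?_
    rw [mul_add]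
    exact add_le_add (h.norm_le n T t ht) (h'.norm_le n T t ht)
  weak_cont n T v := by
    simp only [inner_sub_left]
    exact (h.weak_cont n T v).sub (h'.weak_cont n T v)
  evolution n T ψ s t hs hst ht := by
    have hint : ∀ {G C}, IsWeakHierarchy tstar ν lam C hK G →
        IntervalIntegrable (weakRate ν hK G T ψ) volume s t := fun hG =>
      ((hG.continuousOn_weakRate T ψ).mono (Icc_subset_Icc hs ht)).intervalIntegrable_of_Icc hst
    have e1 := h.evolution n T ψ s t hs hst ht
    have e2 := h'.evolution n T ψ s t hs hst ht
    have e3 := intervalIntegral.integral_sub (hint h) (hint h')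
    rw [show G n T t - G' n T t - (G n T s - G' n T s)
      = (G n T t - G n T s) - (G' n T t - G' n T s) by abel, inner_sub_left, e1, e2]
    refine e3.symm.trans ?_
    congr 1
    funext r
    simp only [weakRate]
    rw [← Finset.sum_sub_distrib]
    refine Finset.sum_congr rfl fun j _ => ?_
    simp only [map_sub, inner_sub_left]
    ring

end IsWeakHierarchy

end Conclusion

/-! ### Stability estimate and uniqueness -/

theorem rescaledTime_eq_mul {d : ℕ} (K : Rd d → Rd d) (ν lam θ t : ℝ) :
    rescaledTime K ν lam θ t
      = (eLpNorm K 2 volume).toReal ^ 2 / (2 * θ * lam * ν) * t := by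
  rw [rescaledTime]
  ring

theorem isWeaklyContinuousVersion_of_ae_eq {d : ℕ} {tstar ν lam C : ℝ} {K : Rd d → Rd d}
    {hK : MemLp K 2 volume} {h : TreeFlow d} {h0 : TreeFamily d}
    {G : ∀ n, LabeledTree n → ℝ → ConfL2 d n} (hG : IsWeakHierarchy tstar ν lam C hK G)
    (hGh : ∀ n (T : LabeledTree n), ∀ᵐ t ∂timeMeasure tstar,
      (G n T t : Conf d n → ℝ) =ᵐ[volume] h n T t)
    (hG0 : ∀ n (T : LabeledTree n), (G n T 0 : Conf d n → ℝ) =ᵐ[volume] h0 n T) :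
    IsWeaklyContinuousVersion tstar h h0 (fun n T t => (G n T t : Conf d n → ℝ)) where
  ae_eq := hGh
  memL2 n T t _ := Lp.memLp _
  weak_cont n T ψ hψ := by
    refine (hG.weak_cont n T (hψ.toLp ψ)).congr fun t _ => ?_
    refine Eq.trans (integral_congr_ae ?_) (L2_real_inner_eq_integral _ _).symm
    filter_upwards [hψ.coeFn_toLp] with x hx
    rw [hx]
  initial := hG0

theorem exists_hierNorm_le (p θ : ℝ) (hp : 1 < p) (hθ : 0 < θ) (hθp : θ < 2 ^ (-(p / (p - 1)))) :
    ∃ C : ℝ≥0, ∀ (d : ℕ) (tstar ν lam : ℝ) (K : Rd d → Rd d) (h : TreeFlow d)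
        (h0 : TreeFamily d),
        0 < tstar → 0 < ν → 0 < lam → MemLp K 2 volume →
        IsHierarchySolution tstar ν K h h0 →
        supHierNorm tstar lam h < ⊤ →
        ∃ g : TreeFlow d, IsWeaklyContinuousVersion tstar h h0 g ∧
          ∀ t ∈ Icc 0 tstar,
            hierNorm (θ * lam) (g.slice t) ≤
                supHierNorm tstar lam h * C *
                  (hierNorm (θ * lam) h0 / supHierNorm tstar lam h) ^
                    (p ^ (-(⌈rescaledTime K ν lam θ t⌉₊ : ℝ))) ∧
            (θ ≤ Real.exp (-1 / Real.log p) →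
              hierNorm (θ * lam) (g.slice t) ≤
                supHierNorm tstar lam h * C *
                  (hierNorm (θ * lam) h0 / supHierNorm tstar lam h) ^
                    (p ^ (-rescaledTime K ν lam θ t))) := by
  have hp0 : 0 < p := by linarith
  have hθ1 := theta_lt_one hp hθp
  have h2θ := two_mul_le_rpow_inv hp hθ hθp
  have hc : 1 ≤ 2 / θ := by rw [le_div_iff₀ hθ]; linarith
  -- The scalar bounds concern squared norms, hence the root; the exponent p' + 1 serves both
  -- estimates.
  refine ⟨Real.toNNReal (√((2 / θ) ^ (p / (p - 1) + 1))),
    fun d tstar ν lam K h h0 ht hν hlam hK hsol hfin => ?_⟩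
  obtain ⟨G, hG, hGh, hG0⟩ := exists_isWeakHierarchy ht hlam hK hsol hfin
  have hσ : 0 ≤ (eLpNorm K 2 volume).toReal ^ 2 / (2 * θ * lam * ν) := by positivity
  refine ⟨_, isWeaklyContinuousVersion_of_ae_eq hG hGh hG0, fun t htm => ⟨?_, fun hθe => ?_⟩⟩
  · refine hierNorm_le_of_forall_sq_le hfin.ne hlam hθ hθ1 hG hG0 htm
      (Real.rpow_pos_of_pos hp0 _) (by positivity) fun hS X hX hx n T => ?_
    refine ((hG.treeInequality hν hlam hS hθ).le_of_rescaled_le_nat hσ hθ hθ1 hp h2θ hX hx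
      ⌈rescaledTime K ν lam θ t⌉₊ n T t htm ?_).trans ?_
    · rw [← rescaledTime_eq_mul]
      exact Nat.le_ceil _
    · gcongr
      linarith
  · refine hierNorm_le_of_forall_sq_le hfin.ne hlam hθ hθ1 hG hG0 htm
      (Real.rpow_pos_of_pos hp0 _) (by positivity) fun hS X hX hx n T => ?_
    rw [rescaledTime_eq_mul]
    exact (hG.treeInequality hν hlam hS hθ).le_of_rescaled_eq hσ hθ hθ1 hp h2θ
      (fun r hr => one_add_mul_le_rpow hp hθ hθp hθe hr) hX hx T htm

theorem IsHierarchySolution.ae_eq_of_same_initial {d : ℕ} {tstar ν lam₁ lam₂ : ℝ}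
    {K : Rd d → Rd d} {h₁ h₂ : TreeFlow d} {h0 : TreeFamily d} (ht : 0 < tstar) (hν : 0 < ν)
    (hlam₁ : 0 < lam₁) (hlam₂ : 0 < lam₂) (hK : MemLp K 2 volume)
    (hsol₁ : IsHierarchySolution tstar ν K h₁ h0) (hsol₂ : IsHierarchySolution tstar ν K h₂ h0)
    (hfin₁ : supHierNorm tstar lam₁ h₁ < ⊤) (hfin₂ : supHierNorm tstar lam₂ h₂ < ⊤) (n : ℕ)
    (T : LabeledTree n) : ∀ᵐ t ∂timeMeasure tstar, h₁ n T t =ᵐ[volume] h₂ n T t := by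
  obtain ⟨G₁, hG₁, hGh₁, hG0₁⟩ := exists_isWeakHierarchy ht hlam₁ hK hsol₁ hfin₁
  obtain ⟨G₂, hG₂, hGh₂, hG0₂⟩ := exists_isWeakHierarchy ht hlam₂ hK hsol₂ hfin₂
  have hlam : 0 < min lam₁ lam₂ := lt_min hlam₁ hlam₂
  -- The summand 1 keeps the normalising constant positive even if both solutions vanish.
  set C := (supHierNorm tstar lam₁ h₁).toReal + (supHierNorm tstar lam₂ h₂).toReal + 1 with hC
  have hC0 : 0 < C := by positivity
  have hD := ((hG₁.mono hlam.le (min_le_left _ _) le_rfl).sub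
    (hG₂.mono hlam.le (min_le_right _ _) le_rfl) hlam.le).mono (C' := C) hlam.le le_rfl
    (by rw [hC]; linarith)
  -- Any admissible pair would do; for p = 2 the threshold 2^{-p'} is 1/4.
  have hθ : (0 : ℝ) < 1 / 8 := by norm_num
  have hθp : (1 / 8 : ℝ) < 2 ^ (-((2 : ℝ) / (2 - 1))) := by norm_num
  have hσ : 0 ≤ (eLpNorm K 2 volume).toReal ^ 2 / (2 * (1 / 8) * min lam₁ lam₂ * ν) := by
    positivity
  have hzero : ∀ t ∈ Icc 0 tstar, G₁ n T t = G₂ n T t := by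
    intro t htm
    -- The difference starts from zero, so X = 0 is allowed; the number of unit steps is the ceiling
    -- of the rescaled time.
    have h1 := (hD.treeInequality hν hlam hC0 hθ).le_of_rescaled_le_nat hσ hθ (by norm_num)
      one_lt_two (two_mul_le_rpow_inv one_lt_two hθ hθp) le_rfl (fun n T => by
        have : G₁ n T 0 = G₂ n T 0 := Lp.ext ((hG0₁ n T).trans (hG0₂ n T).symm)
        simp [this]) _ n T t htm (Nat.le_ceil _)
    rw [Real.zero_rpow (Real.rpow_pos_of_pos two_pos _).ne', mul_zero,
      div_le_iff₀ (by positivity), zero_mul] at h1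
    have h2 : ‖G₁ n T t - G₂ n T t‖ ^ 2 = 0 :=
      le_antisymm (nonpos_of_mul_nonpos_right h1 (by positivity)) (by positivity)
    rwa [pow_eq_zero_iff two_ne_zero, norm_eq_zero, sub_eq_zero] at h2
  filter_upwards [hGh₁ n T, hGh₂ n T, ae_restrict_mem measurableSet_Icc] with t h1 h2 h3
  rw [hzero t h3] at h1
  exact h1.symm.trans h2

theorem mainTheorem4 :
    (∀ p θ : ℝ, 1 < p → 0 < θ → θ < 2 ^ (-(p / (p - 1))) →
      ∃ C : ℝ≥0, ∀ (d : ℕ) (tstar ν lam : ℝ) (K : Rd d → Rd d) (h : TreeFlow d)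
        (h0 : TreeFamily d),
        0 < tstar → 0 < ν → 0 < lam → MemLp K 2 volume →
        IsHierarchySolution tstar ν K h h0 →
        supHierNorm tstar lam h < ⊤ →
        ∃ g : TreeFlow d, IsWeaklyContinuousVersion tstar h h0 g ∧
          ∀ t ∈ Icc 0 tstar,
            hierNorm (θ * lam) (g.slice t) ≤
                supHierNorm tstar lam h * C *
                  (hierNorm (θ * lam) h0 / supHierNorm tstar lam h) ^
                    (p ^ (-(⌈rescaledTime K ν lam θ t⌉₊ : ℝ))) ∧
            (θ ≤ Real.exp (-1 / Real.log p) →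
              hierNorm (θ * lam) (g.slice t) ≤
                supHierNorm tstar lam h * C *
                  (hierNorm (θ * lam) h0 / supHierNorm tstar lam h) ^
                    (p ^ (-rescaledTime K ν lam θ t)))) ∧
    (∀ (d : ℕ) (tstar ν lam₁ lam₂ : ℝ) (K : Rd d → Rd d) (h₁ h₂ : TreeFlow d)
      (h0 : TreeFamily d),
      0 < tstar → 0 < ν → 0 < lam₁ → 0 < lam₂ → MemLp K 2 volume →
      IsHierarchySolution tstar ν K h₁ h0 →
      IsHierarchySolution tstar ν K h₂ h0 →
      supHierNorm tstar lam₁ h₁ < ⊤ →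
      supHierNorm tstar lam₂ h₂ < ⊤ →
      ∀ n (T : LabeledTree n), ∀ᵐ t ∂(timeMeasure tstar),
        h₁ n T t =ᵐ[volume] h₂ n T t) :=
  ⟨exists_hierNorm_le, fun _ _ _ _ _ _ _ _ _ ht hν h1 h2 hK hs1 hs2 hf1 hf2 n T =>
    IsHierarchySolution.ae_eq_of_same_initial ht hν h1 h2 hK hs1 hs2 hf1 hf2 n T⟩
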